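/- Let $\Omega$ be a locally compact second countable Hausdorff space, $\mathcal H$ a complex separable Hilbert space and $\mathcal L(\mathcal H)$ the bounded operators on $\mathcal H$. Let $C_0(\Omega)$ be the space of continuous complex functions on $\Omega$ vanishing at infinity, and let $B(\Omega)^+$ be the set of positive Borel measures $\nu$ on $\Omega$ with $\nu(\Omega)\le 1$, endowed with the weak*-topology, that is, the coarsest topology for which all maps $\nu\mapsto\nu(f):=\int_\Omega f\,d\nu$, $f\in C_0(\Omega)$, are continuous. A positive operator valued measure (POVM) on $\Omega$ is regarded as a linear map $E:C_0(\Omega)\to\mathcal L(\mathcal H)$ such that $E(f)\ge 0$ if $f\ge 0$, and such that $E(f_n)\uparrow I$ whenever $0\le f_n\uparrow 1$ pointwise with $f_n\in C_0(\Omega)$. It is commutative if the operators $E(f)$, $f\in C_0(\Omega)$, commute with each other; $E'$ denotes the commutant of $\{E(f)\mid f\in C_0(\Omega)\}$ in $\mathcal L(\mathcal H)$. A projection valued measure (PVM) on a compact metrizable space $\Sigma$ is a map $P$ from the Borel sets of $\Sigma$ to the positive operators on $\mathcal H$ that is countably additive in the weak operator topology, with $P(\Sigma)=I$ and $P(X)P(Y)=P(X\cap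 Y)$ for all Borel sets $X,Y$. Its support $\operatorname{supp}P$ is the set of the points all of whose open neighbourhoods $U$ have $P(U)\neq 0$. For $\phi\in C(\Sigma)$ the operator $P(\phi)=\int_\Sigma\phi\,dP$ is given by $\langle\psi,P(\phi)\psi\rangle=\int_\Sigma\phi(h)\,\langle\psi,P(dh)\psi\rangle$ for all $\psi\in\mathcal H$, and $P'$ denotes the commutant of $\{P(\phi)\mid\phi\in C(\Sigma)\}$ in $\mathcal L(\mathcal H)$. **Theorem.** Let $E:C_0(\Omega)\to\mathcal L(\mathcal H)$ be a commutative POVM. Then there exists a triple $(\Sigma,P,\mu)$ such that (i) $\Sigma$ is a compact metrizable space (possibly empty, which occurs only if $\mathcal H=0$); (ii) $P$ is a PVM on $\Sigma$ with values in $\mathcal L(\mathcal H)$ and $\operatorname{supp}P=\Sigma$; (iii) $\mu:\Sigma\to B(\Omega)^+$ is a weak*-continuous injective map; (iv) for all $f\in C_0(\Omega)$, $$E(f)=\int_\Sigma[\mu(h)](f)\,dP(h).$$ If $(\tilde\Sigma,\tilde P,\tilde\mu)$ is another triple satisfying (i)–(iv), then there exists a homeomorphism $\Phi:\Sigma\to\tilde\Sigma$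 such that $\tilde P(X)=P(\Phi^{-1}(X))$ for all Borel sets $X\subseteq\tilde\Sigma$ and $\mu=\tilde\mu\circ\Phi$. Moreover, $P'=E'$. -/

import Mathlib

open MeasureTheory Topology Filter
open scoped ZeroAtInfty ComplexOrder ENNReal

universe u v w

noncomputable section

/-- A positive operator valued measure on a measurable space `X` with values in `H`, as a
set function (its values on non-measurable sets are irrelevant). Countable additivity is with
respect to the weak operator topology. -/
structure POVM (X H : Type*) [MeasurableSpace X] [NormedAddCommGroup H]
    [InnerProductSpace ℂ H] [CompleteSpace H] where
  toFun : Set X → (H →L[ℂ] H)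
  isPositive : ∀ A, MeasurableSet A → (toFun A).IsPositive
  univ : toFun Set.univ = 1
  hasSum_iUnion : ∀ A : ℕ → Set X, (∀ i, MeasurableSet (A i)) →
    Pairwise (fun i j => Disjoint (A i) (A j)) →
    ∀ u v : H, HasSum (fun i => inner ℂ u (toFun (A i) v)) (inner ℂ u (toFun (⋃ i, A i) v))

/-- A projection valued measure (sharp observable). -/
structure PVM (X H : Type*) [MeasurableSpace X] [NormedAddCommGroup H]
    [InnerProductSpace ℂ H] [CompleteSpace H] extends POVM X H where
  mul_eq : ∀ A B, MeasurableSet A → MeasurableSet B → toFun A * toFun B = toFun (A ∩ B)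

namespace POVM

variable {X H : Type*} [MeasurableSpace X] [NormedAddCommGroup H]
  [InnerProductSpace ℂ H] [CompleteSpace H]

lemma toFun_empty (P : POVM X H) : P.toFun ∅ = 0 := by
  ext v
  refine ext_inner_left ℂ fun u => ?_
  have h := P.hasSum_iUnion (fun _ => ∅) (fun _ => MeasurableSet.empty)
    (fun _ _ _ => disjoint_bot_left) u v
  have h0 := h.summable.tendsto_atTop_zero
  simpa using tendsto_nhds_unique tendsto_const_nhds h0

/-- The measure `A ↦ ⟪ψ, P(A) ψ⟫`. -/
def vecMeasure (P : POVM X H) (ψ : H) : Measure X :=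
  Measure.ofMeasurable (fun A _ => ENNReal.ofReal (inner ℂ ψ (P.toFun A ψ)).re)
    (by simp [P.toFun_empty])
    (by
      intro A hA hd
      have h := Complex.hasSum_re (P.hasSum_iUnion A hA hd ψ ψ)
      rw [← h.tsum_eq, ENNReal.ofReal_tsum_of_nonneg _ h.summable]
      intro i
      exact (P.isPositive (A i) (hA i)).re_inner_nonneg_right ψ)

/-- `P.IsIntegral φ T` says that `T = ∫ φ dP`, in the weak sense:
`⟪ψ, T ψ⟫ = ∫ φ(x) ⟪ψ, P(dx) ψ⟫` for every vector `ψ`. For a bounded measurable `φ` there is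
exactly one such operator `T`. -/
def IsIntegral (P : POVM X H) (φ : X → ℂ) (T : H →L[ℂ] H) : Prop :=
  ∀ ψ : H, inner ℂ ψ (T ψ) = ∫ x, φ x ∂(P.vecMeasure ψ)

/-- The closed support. -/
def support [TopologicalSpace X] (P : POVM X H) : Set X :=
  {x | ∀ U : Set X, IsOpen U → x ∈ U → P.toFun U ≠ 0}

/-- The commutant `P'` of the set of operators `∫ φ dP`, `φ ∈ C₀(X)`. -/
def commutant [TopologicalSpace X] (P : POVM X H) : Set (H →L[ℂ] H) :=
  Set.centralizer {T | ∃ φ : C₀(X, ℂ), P.IsIntegral φ T}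

end POVM

/-- A positive operator valued measure on a locally compact second countable Hausdorff space,
as a positive linear map on `C₀(Ω)` with `E(fₙ) ↑ I` whenever `0 ≤ fₙ ↑ 1`. (Monotonicity of
`E(fₙ)` is a consequence of positivity.) -/
structure FunctionalPOVM (Ω H : Type*) [TopologicalSpace Ω] [NormedAddCommGroup H]
    [InnerProductSpace ℂ H] [CompleteSpace H] where
  toLinearMap : C₀(Ω, ℂ) →ₗ[ℂ] (H →L[ℂ] H)
  isPositive : ∀ f : C₀(Ω, ℂ), (∀ x, 0 ≤ f x) → (toLinearMap f).IsPositive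
  tendsto_one : ∀ f : ℕ → C₀(Ω, ℂ), (∀ n x, 0 ≤ f n x) → (∀ x, Monotone fun n => f n x) →
    (∀ x, Tendsto (fun n => f n x) atTop (𝓝 1)) →
    ∀ u v : H, Tendsto (fun n => inner ℂ u (toLinearMap (f n) v)) atTop (𝓝 (inner ℂ u v))

namespace FunctionalPOVM

variable {Ω H : Type*} [TopologicalSpace Ω] [NormedAddCommGroup H]
  [InnerProductSpace ℂ H] [CompleteSpace H]

/-- The commutant `E'` of the set of operators `E(f)`, `f ∈ C₀(Ω)`. -/
def commutant (E : FunctionalPOVM Ω H) : Set (H →L[ℂ] H) :=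
  Set.centralizer (Set.range E.toLinearMap)

/-- Commutativity of a positive operator valued measure. -/
def IsCommutative (E : FunctionalPOVM Ω H) : Prop :=
  ∀ f, E.toLinearMap f ∈ E.commutant

end FunctionalPOVM

/-- The positive part `B(Ω)⁺` of the unit ball of the space of complex Borel measures on `Ω`:
the positive measures of total mass at most one. -/
def PosBall (Ω : Type*) [MeasurableSpace Ω] : Type _ :=
  {ν : Measure Ω // ν Set.univ ≤ 1}

/-- The pairing `ν(f) = ∫ f dν`. -/
def PosBall.pairing {Ω : Type*} [TopologicalSpace Ω] [MeasurableSpace Ω] (ν : PosBall Ω)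
    (f : C₀(Ω, ℂ)) : ℂ :=
  ∫ x, f x ∂ν.1

/-- The weak* topology, i.e. the coarsest one for which all `ν ↦ ν(f)`, `f ∈ C₀(Ω)`, are
continuous. -/
instance {Ω : Type*} [TopologicalSpace Ω] [MeasurableSpace Ω] : TopologicalSpace (PosBall Ω) :=
  TopologicalSpace.induced (fun ν (f : C₀(Ω, ℂ)) => ν.pairing f) inferInstance

/-- The conditions on a triple `(S, P, μ)`, where `S` is a compact metrizable space and `P` is
a projection valued measure on its Borel sets, to represent `E`. -/
structure FunctionalPOVM.IsRepresentation {Ω S H : Type*} [TopologicalSpace Ω]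
    [MeasurableSpace Ω] [NormedAddCommGroup H] [InnerProductSpace ℂ H] [CompleteSpace H]
    [TopologicalSpace S] [MeasurableSpace S]
    (E : FunctionalPOVM Ω H) (P : PVM S H) (μ : S → PosBall Ω) : Prop where
  support_eq : P.support = Set.univ
  continuous : Continuous μ
  injective : Function.Injective μ
  isIntegral : ∀ f : C₀(Ω, ℂ), P.IsIntegral (fun h => (μ h).pairing f) (E.toLinearMap f)

end

/-! Let `M` be the commutative von Neumann algebra generated by the operators `E(f)`. A character
`χ` of `M` composed with `E` is a positive functional on `C₀(Ω)`, hence a point `m(χ)` of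
`B(Ω)⁺`, and `Σ` is the image of the character space under the continuous map `m`. Pulling back
along `m` and inverting the Gelfand transform embeds `C(Σ)` into `M`, mapping the function
`ν ↦ ν(f)` to `E(f)`; this embedding is integration against a projection valued measure `P`, which
has full support because the embedding is injective. As all `E(f)` are in the image of `C(Σ)`,
which lies in `M = E''`, the commutants agree.

For uniqueness, push the projection valued measures of two representations forward to the compact
metrizable space `B(Ω)⁺`. The continuous functions on it with equal integrals form a `*`-algebra,
which contains the functions `ν ↦ ν(f)` and hence is dense by Stone–Weierstrass, so the two images
coincide. In particular they have the same support, which is the range of both maps `μ`, and these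
maps are homeomorphisms onto it. -/

noncomputable section

section QuadraticForm

variable {H : Type*} [NormedAddCommGroup H] [InnerProductSpace ℂ H]

lemma inner_apply_eq_polarization (T : H →L[ℂ] H) (x y : H) :
    inner ℂ x (T y) = (inner ℂ (x + y) (T (x + y)) - inner ℂ (x - y) (T (x - y))
      - Complex.I * inner ℂ (x + Complex.I • y) (T (x + Complex.I • y))
      + Complex.I * inner ℂ (x - Complex.I • y) (T (x - Complex.I • y))) / 4 := by
  simp only [map_add, map_sub, map_smul, inner_add_left, inner_add_right, inner_sub_left,
    inner_sub_right, inner_smul_left, inner_smul_right, Complex.conj_I]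
  linear_combination ((inner ℂ x (T y) - inner ℂ y (T x)) / 2) * Complex.I_sq

lemma eq_of_inner_apply_self_eq {T T' : H →L[ℂ] H}
    (h : ∀ ψ, inner ℂ ψ (T ψ) = inner ℂ ψ (T' ψ)) : T = T' := by
  ext v
  refine ext_inner_left ℂ fun u => ?_
  simp only [inner_apply_eq_polarization _ u v, h]

lemma tendsto_inner_of_tendsto_inner_self {ι : Type*} {l : Filter ι} {T : ι → H →L[ℂ] H}
    {T' : H →L[ℂ] H}
    (h : ∀ ψ, Tendsto (fun i => inner ℂ ψ (T i ψ)) l (𝓝 (inner ℂ ψ (T' ψ)))) (x y : H) :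
    Tendsto (fun i => inner ℂ x (T i y)) l (𝓝 (inner ℂ x (T' y))) := by
  simp only [inner_apply_eq_polarization _ x y]
  exact (((h _).sub (h _)).sub ((h _).const_mul _) |>.add ((h _).const_mul _)).div_const _

lemma isPositive_of_inner_self_nonneg {T : H →L[ℂ] H} (h : ∀ ψ, 0 ≤ inner ℂ ψ (T ψ)) :
    T.IsPositive := by
  refine (ContinuousLinearMap.isPositive_iff_complex T).2 fun ψ => ?_
  have h' : 0 ≤ inner ℂ (T ψ) ψ := by
    rw [← inner_conj_symm, starRingEnd_apply, star_nonneg_iff]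
    exact h ψ
  exact ⟨(Complex.eq_re_of_ofReal_le (r := 0) (by simpa using h')).symm,
    (Complex.nonneg_iff.1 h').1⟩

variable [CompleteSpace H]

lemma norm_le_one_of_inner_self_le {T : H →L[ℂ] H} (h0 : ∀ ψ, 0 ≤ inner ℂ ψ (T ψ))
    (h1 : ∀ ψ, inner ℂ ψ (T ψ) ≤ inner ℂ ψ ψ) : ‖T‖ ≤ 1 := by
  have hT : 0 ≤ T :=
    ContinuousLinearMap.nonneg_iff_isPositive T |>.2 (isPositive_of_inner_self_nonneg h0)
  refine (CStarAlgebra.norm_le_one_iff_of_nonneg T hT).2 ?_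
  refine (ContinuousLinearMap.le_def T 1).2 (isPositive_of_inner_self_nonneg fun ψ => ?_)
  simpa [inner_sub_right] using h1 ψ

lemma exists_inner_self_eq_of_tendsto {ι : Type*} {l : Filter ι} [l.NeBot] {T : ι → H →L[ℂ] H}
    {C : ℝ} {q : H → ℂ} (hC : ∀ i, ‖T i‖ ≤ C)
    (hq : ∀ ψ, Tendsto (fun i => inner ℂ ψ (T i ψ)) l (𝓝 (q ψ))) :
    ∃ T' : H →L[ℂ] H, ∀ ψ, inner ℂ ψ (T' ψ) = q ψ := by
  have hlim : ∀ x y, ∃ b, Tendsto (fun i => inner ℂ x (T i y)) l (𝓝 b) := fun x y => by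
    simp only [inner_apply_eq_polarization _ x y]
    exact ⟨_, (((hq _).sub (hq _)).sub ((hq _).const_mul _) |>.add
      ((hq _).const_mul _)).div_const _⟩
  choose b hb using hlim
  let B : H →ₗ⋆[ℂ] H →ₗ[ℂ] ℂ := LinearMap.mk₂'ₛₗ (starRingEnd ℂ) (RingHom.id ℂ) b
    (fun x x' y => tendsto_nhds_unique (hb _ _)
      (((hb x y).add (hb x' y)).congr fun i => (inner_add_left _ _ _).symm))
    (fun c x y => tendsto_nhds_unique (hb _ _)
      (((hb x y).const_mul _).congr fun i => (inner_smul_left _ _ _).symm))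
    (fun x y y' => tendsto_nhds_unique (hb _ _)
      (((hb x y).add (hb x y')).congr fun i => by rw [map_add, inner_add_right]))
    (fun c x y => tendsto_nhds_unique (hb _ _)
      (((hb x y).const_mul _).congr fun i => by rw [map_smul, inner_smul_right, RingHom.id_apply]))
  have hB : ∀ x y, ‖B x y‖ ≤ C * ‖x‖ * ‖y‖ := fun x y =>
    le_of_tendsto (hb x y).norm <| Eventually.of_forall fun i => calc
      ‖inner ℂ x (T i y)‖ ≤ ‖x‖ * ‖T i y‖ := norm_inner_le_norm _ _
      _ ≤ ‖x‖ * (C * ‖y‖) := by gcongr; exact (T i).le_of_opNorm_le (hC i) y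
      _ = C * ‖x‖ * ‖y‖ := by ring
  refine ⟨(InnerProductSpace.continuousLinearMapOfBilin (B.mkContinuous₂ C hB)).adjoint,
    fun ψ => ?_⟩
  rw [ContinuousLinearMap.adjoint_inner_right,
    InnerProductSpace.continuousLinearMapOfBilin_apply]
  exact tendsto_nhds_unique (hb ψ ψ) (hq ψ)

end QuadraticForm

section VanishingAtInfinity

open scoped CompactlySupported

variable {X Y Z : Type*} [TopologicalSpace X] [TopologicalSpace Y] [TopologicalSpace Z]

/-- The composition `p ∘ f` of a function `f` vanishing at infinity with a continuous map `p`
fixing zero. -/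
def compC0 [Zero Y] [Zero Z] (p : C(Y, Z)) (hp : p 0 = 0) (f : C₀(X, Y)) : C₀(X, Z) where
  toContinuousMap := p.comp f.toContinuousMap
  zero_at_infty' := by
    have h := (p.continuous.tendsto 0).comp (zero_at_infty f)
    rwa [hp] at h

@[simp]
lemma compC0_apply [Zero Y] [Zero Z] (p : C(Y, Z)) (hp : p 0 = 0) (f : C₀(X, Y)) (x : X) :
    compC0 p hp f x = p (f x) := rfl

/-- The inclusion `C₀(X, ℝ) → C₀(X, ℂ)`. -/
def ofRealC0 : C₀(X, ℝ) →ₗ[ℝ] C₀(X, ℂ) where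
  toFun := compC0 ⟨Complex.ofReal, Complex.continuous_ofReal⟩ Complex.ofReal_zero
  map_add' f g := by ext x; simp
  map_smul' c f := by ext x; simp

@[simp]
lemma ofRealC0_apply (f : C₀(X, ℝ)) (x : X) : ofRealC0 f x = f x := rfl

/-- The real part of a function vanishing at infinity. -/
def reC0 (f : C₀(X, ℂ)) : C₀(X, ℝ) := compC0 ⟨Complex.re, Complex.continuous_re⟩ rfl f

@[simp]
lemma reC0_apply (f : C₀(X, ℂ)) (x : X) : reC0 f x = (f x).re := rfl

lemma ofRealC0_reC0_of_nonneg {f : C₀(X, ℂ)} (hf : ∀ x, 0 ≤ f x) : ofRealC0 (reC0 f) = f := by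
  ext x
  exact (Complex.eq_re_of_ofReal_le (r := 0) (by simpa using hf x)).symm

lemma ofRealC0_mem_span_nonneg (f : C₀(X, ℝ)) :
    ofRealC0 f ∈ Submodule.span ℂ {g : C₀(X, ℂ) | ∀ x, 0 ≤ g x} := by
  let pos (g : C₀(X, ℝ)) : C₀(X, ℝ) := compC0 ⟨fun t => max t 0, by fun_prop⟩ (max_self 0) g
  have hpos : ∀ g, ofRealC0 (pos g) ∈ Submodule.span ℂ {g : C₀(X, ℂ) | ∀ x, 0 ≤ g x} := fun g =>
    Submodule.subset_span fun x => Complex.zero_le_real.2 (le_max_right _ _)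
  have hf : f = pos f - pos (-f) := by
    ext x
    exact (posPart_sub_negPart (f x)).symm
  rw [hf, map_sub]
  exact Submodule.sub_mem _ (hpos f) (hpos (-f))

lemma span_nonneg_eq_top : Submodule.span ℂ {f : C₀(X, ℂ) | ∀ x, 0 ≤ f x} = ⊤ := by
  refine eq_top_iff.2 fun f _ => ?_
  have hf : f = ofRealC0 (reC0 f) + Complex.I • ofRealC0 (reC0 (-Complex.I • f)) := by
    ext x
    apply Complex.ext <;> simp
  rw [hf]
  exact Submodule.add_mem _ (ofRealC0_mem_span_nonneg _)
    (Submodule.smul_mem _ _ (ofRealC0_mem_span_nonneg _))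

lemma norm_apply_le_norm {Y : Type*} [NormedAddCommGroup Y] (f : C₀(X, Y)) (x : X) : ‖f x‖ ≤ ‖f‖ :=
  f.toBCF.norm_coe_le_norm x

lemma denseRange_compactlySupported [T2Space X] :
    DenseRange fun f : C_c(X, ℝ) => (f : C₀(X, ℝ)) := by
  refine Metric.denseRange_iff.2 fun f ε hε => ?_
  obtain ⟨δ, hδ, hδε⟩ := exists_between hε
  let s : C₀(X, ℝ) := compC0 ⟨fun t => max (-δ) (min t δ), by fun_prop⟩ (by simp [hδ.le]) f
  obtain ⟨K, hK, hKf⟩ := mem_cocompact.1 ((zero_at_infty f).norm.eventually_lt_const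
    (by simpa using hδ))
  have hs : ∀ x ∉ K, s x = f x := fun x hx => by
    have h := abs_lt.1 (show |f x| < δ from hKf hx)
    simp [s, h.1.le, h.2.le]
  refine ⟨⟨(f - s).toContinuousMap, HasCompactSupport.intro hK fun x hx => ?_⟩, ?_⟩
  · simp [hs x hx]
  · refine lt_of_le_of_lt ?_ hδε
    refine (BoundedContinuousFunction.dist_le hδ.le).2 fun x => ?_
    change |f x - (f x - s x)| ≤ δ
    rw [sub_sub_cancel]
    exact abs_le.2 ⟨le_max_left _ _, max_le (by linarith) (min_le_right _ _)⟩

/-- A positive functional is bounded by its supremum over `0 ≤ f ≤ 1`, since `|Λ f| ≤ Λ |f|`. -/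
lemma abs_apply_le_of_nonneg {Λ : C₀(X, ℝ) →ₗ[ℝ] ℝ} {C : ℝ}
    (hpos : ∀ f : C₀(X, ℝ), (∀ x, 0 ≤ f x) → 0 ≤ Λ f)
    (hC : ∀ f : C₀(X, ℝ), (∀ x, 0 ≤ f x) → (∀ x, f x ≤ 1) → Λ f ≤ C) (f : C₀(X, ℝ)) :
    |Λ f| ≤ C * ‖f‖ := by
  let a : C₀(X, ℝ) := compC0 ⟨fun t => |t|, by fun_prop⟩ abs_zero f
  have ha : ∀ x, a x = |f x| := fun _ => rfl
  have h1 : 0 ≤ Λ a - Λ f := by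
    rw [← map_sub]
    exact hpos _ fun x => sub_nonneg.2 (le_abs_self (f x))
  have h2 : 0 ≤ Λ a + Λ f := by
    rw [← map_add]
    exact hpos _ fun x => neg_le_iff_add_nonneg.1 (neg_le_abs (f x))
  refine (abs_le.2 ⟨by linarith, by linarith⟩ : |Λ f| ≤ Λ a).trans ?_
  rcases eq_or_ne f 0 with rfl | hf
  · have : a = 0 := by ext x; simp [ha]
    simp [this]
  have hn : 0 < ‖f‖ := norm_pos_iff.2 hf
  have h := hC (‖f‖⁻¹ • a)
    (fun x => mul_nonneg (inv_nonneg.2 hn.le) (abs_nonneg (f x)))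
    (fun x => inv_mul_le_one_of_le₀ (norm_apply_le_norm f x) hn.le)
  rwa [map_smul, smul_eq_mul, inv_mul_le_iff₀ hn, mul_comm] at h

variable [MeasurableSpace X] [BorelSpace X]

lemma integrable_zeroAtInfty {𝕜 : Type*} [RCLike 𝕜] {ν : Measure X} [IsFiniteMeasure ν]
    (f : C₀(X, 𝕜)) : Integrable f ν :=
  Integrable.of_bound (map_continuous f).measurable.aestronglyMeasurable ‖f‖
    (Eventually.of_forall (norm_apply_le_norm f))

/-- Integration against a finite measure, as a functional on `C₀(X, 𝕜)`. -/
def integralC0 (𝕜 : Type*) [RCLike 𝕜] (ν : Measure X) [IsFiniteMeasure ν] : C₀(X, 𝕜) →L[𝕜] 𝕜 :=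
  LinearMap.mkContinuous
    { toFun := fun f => ∫ x, f x ∂ν
      map_add' := fun f g => integral_add (integrable_zeroAtInfty f) (integrable_zeroAtInfty g)
      map_smul' := fun c f => integral_const_mul c f }
    (ν.real Set.univ) fun f => by
      rw [mul_comm]
      exact norm_integral_le_of_norm_le_const (Eventually.of_forall (norm_apply_le_norm f))

variable [T2Space X] [LocallyCompactSpace X]

lemma rieszMarkovKakutani_compactlySupported {Λ : C_c(X, ℝ) →ₗ[ℝ] ℝ} {C : ℝ}
    (hpos : ∀ f : C_c(X, ℝ), 0 ≤ f → 0 ≤ Λ f)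
    (hC : ∀ f : C_c(X, ℝ), 0 ≤ f → (∀ x, f x ≤ 1) → Λ f ≤ C) :
    ∃ ν : Measure X, ν Set.univ ≤ ENNReal.ofReal C ∧ ∀ f : C_c(X, ℝ), Λ f = ∫ x, f x ∂ν := by
  let L : C_c(X, ℝ) →ₚ[ℝ] ℝ := PositiveLinearMap.mk₀ Λ hpos
  refine ⟨RealRMK.rieszMeasure L, ?_, fun f => (RealRMK.integral_rieszMeasure L f).symm⟩
  rw [isOpen_univ.measure_eq_iSup_isCompact]
  refine iSup_le fun K => iSup_le fun _ => iSup_le fun hK => ?_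
  obtain ⟨f, hf1, hf, -, hf01⟩ :=
    exists_continuousMap_one_of_isCompact_subset_isOpen hK isOpen_univ (Set.subset_univ _)
  exact (RealRMK.rieszMeasure_le_of_eq_one L (f := ⟨f, hf⟩) (fun x => (hf01 x).1) hK
    fun x hx => hf1 hx).trans (ENNReal.ofReal_le_ofReal
      (hC ⟨f, hf⟩ (fun x => (hf01 x).1) fun x => (hf01 x).2))

lemma rieszMarkovKakutani_real {Λ : C₀(X, ℝ) →ₗ[ℝ] ℝ} {C : ℝ}
    (hpos : ∀ f : C₀(X, ℝ), (∀ x, 0 ≤ f x) → 0 ≤ Λ f)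
    (hC : ∀ f : C₀(X, ℝ), (∀ x, 0 ≤ f x) → (∀ x, f x ≤ 1) → Λ f ≤ C) :
    ∃ ν : Measure X, ν Set.univ ≤ ENNReal.ofReal C ∧ ∀ f : C₀(X, ℝ), Λ f = ∫ x, f x ∂ν := by
  let ι : C_c(X, ℝ) →ₗ[ℝ] C₀(X, ℝ) :=
    { toFun := fun f => (f : C₀(X, ℝ)), map_add' := fun _ _ => rfl, map_smul' := fun _ _ => rfl }
  obtain ⟨ν, hν, hνι⟩ := rieszMarkovKakutani_compactlySupported (Λ := Λ ∘ₗ ι) (C := C)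
    (fun f hf => hpos _ hf) (fun f hf hf1 => hC _ hf hf1)
  have : IsFiniteMeasure ν := ⟨hν.trans_lt ENNReal.ofReal_lt_top⟩
  have hΛ : Continuous Λ := (Λ.mkContinuous C (abs_apply_le_of_nonneg hpos hC)).continuous
  exact ⟨ν, hν, congrFun (denseRange_compactlySupported.equalizer hΛ
    (integralC0 ℝ ν).continuous (funext hνι))⟩

theorem rieszMarkovKakutani_complex {Λ : C₀(X, ℂ) →ₗ[ℂ] ℂ} {C : ℝ}
    (hpos : ∀ f : C₀(X, ℂ), (∀ x, 0 ≤ f x) → 0 ≤ Λ f)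
    (hC : ∀ f : C₀(X, ℂ), (∀ x, 0 ≤ f x) → (∀ x, f x ≤ 1) → Λ f ≤ C) :
    ∃ ν : Measure X, ν Set.univ ≤ ENNReal.ofReal C ∧ ∀ f : C₀(X, ℂ), Λ f = ∫ x, f x ∂ν := by
  obtain ⟨ν, hν, hΛν⟩ := rieszMarkovKakutani_real (C := C)
    (Λ := Complex.reLm ∘ₗ Λ.restrictScalars ℝ ∘ₗ ofRealC0)
    (fun f hf => (Complex.nonneg_iff.1 (hpos _ fun x => Complex.zero_le_real.2 (hf x))).1)
    (fun f hf hf1 => (Complex.le_def.1 (hC _ (fun x => Complex.zero_le_real.2 (hf x))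
      fun x => by simpa using Complex.real_le_real.2 (hf1 x))).1)
  have : IsFiniteMeasure ν := ⟨hν.trans_lt ENNReal.ofReal_lt_top⟩
  refine ⟨ν, hν, fun f => ?_⟩
  suffices h : Λ = (integralC0 ℂ ν).toLinearMap from congrArg (· f) h
  refine LinearMap.ext_on span_nonneg_eq_top fun g hg => ?_
  have hr : Λ g = ((Λ g).re : ℂ) := Complex.eq_re_of_ofReal_le (r := 0) (by simpa using hpos g hg)
  rw [hr, ← ofRealC0_reC0_of_nonneg hg]
  exact (congrArg _ (hΛν _)).trans integral_ofReal.symm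

end VanishingAtInfinity

section Separation

variable {X : Type*} [TopologicalSpace X]

lemma exists_monotone_tendsto_indicator [T2Space X] [LocallyCompactSpace X]
    [SecondCountableTopology X] {U : Set X} (hU : IsOpen U) :
    ∃ f : ℕ → C₀(X, ℝ), (∀ n x, f n x ∈ Set.Icc (0 : ℝ) 1) ∧ (∀ x, Monotone fun n => f n x) ∧
      ∀ x, Tendsto (fun n => f n x) atTop (𝓝 (U.indicator 1 x)) := by
  have : LocallyCompactSpace U := hU.locallyCompactSpace
  let K : CompactExhaustion U := CompactExhaustion.choice U
  let A (n : ℕ) : Set X := Subtype.val '' K n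
  let V (n : ℕ) : Set X := Subtype.val '' interior (K (n + 1))
  have hVA : ∀ n, V n ⊆ A (n + 1) := fun n => Set.image_mono interior_subset
  have hVU : ∀ n, V n ⊆ U := fun n => Subtype.coe_image_subset U _
  choose f hf1 hfc hfV hf01 using fun n => exists_continuousMap_one_of_isCompact_subset_isOpen
    ((K.isCompact n).image continuous_subtype_val)
    (hU.isOpenMap_subtype_val _ isOpen_interior)
    (Set.image_mono (K.subset_interior_succ n) : A n ⊆ V n)
  have hf0 : ∀ n, ∀ x ∉ V n, f n x = 0 := fun n x hx =>
    image_eq_zero_of_notMem_tsupport fun h => hx (hfV n h)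
  refine ⟨fun n => ⟨f n, HasCompactSupport.is_zero_at_infty (hfc n)⟩, hf01,
    fun x => monotone_nat_of_le_succ fun n => ?_, fun x => ?_⟩
  · change f n x ≤ f (n + 1) x
    by_cases hx : x ∈ V n
    · exact (hf01 n x).2.trans_eq (hf1 (n + 1) (hVA n hx)).symm
    · exact (hf0 n x hx).trans_le (hf01 (n + 1) x).1
  · by_cases hx : x ∈ U
    · obtain ⟨N, hN⟩ := K.exists_mem ⟨x, hx⟩
      rw [Set.indicator_of_mem hx]
      refine tendsto_const_nhds.congr' ?_
      filter_upwards [eventually_ge_atTop N] with n hn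
      exact (hf1 n ⟨⟨x, hx⟩, K.subset hn hN, rfl⟩).symm
    · rw [Set.indicator_of_notMem hx]
      exact tendsto_const_nhds.congr fun n => (hf0 n x fun h => hx (hVU n h)).symm

lemma exists_countable_isPiSystem_isOpen (X : Type*) [TopologicalSpace X]
    [SecondCountableTopology X] :
    ∃ b : Set (Set X), b.Countable ∧ IsPiSystem b ∧ Set.univ ∈ b ∧ (∀ U ∈ b, IsOpen U) ∧
      borel X = MeasurableSpace.generateFrom b := by
  let b : Set (Set X) :=
    (fun f => ⋂₀ f) '' {f | f.Finite ∧ f ⊆ TopologicalSpace.countableBasis X}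
  have hb : TopologicalSpace.IsTopologicalBasis b :=
    TopologicalSpace.isTopologicalBasis_of_subbasis
      (TopologicalSpace.isBasis_countableBasis X).eq_generateFrom
  refine ⟨b, (Set.countable_ofPred_finite_subset
    (TopologicalSpace.countable_countableBasis X)).image _, ?_,
    ⟨∅, ⟨Set.finite_empty, Set.empty_subset _⟩, Set.sInter_empty⟩, fun U => hb.isOpen,
    hb.borel_eq_generateFrom⟩
  rintro _ ⟨s, ⟨hs, hs'⟩, rfl⟩ _ ⟨t, ⟨ht, ht'⟩, rfl⟩ -
  exact ⟨s ∪ t, ⟨hs.union ht, Set.union_subset hs' ht'⟩, Set.sInter_union _ _⟩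

lemma tendsto_integral_measureReal [MeasurableSpace X] [BorelSpace X] {ν : Measure X}
    [IsFiniteMeasure ν] {U : Set X} (hU : MeasurableSet U) {f : ℕ → C₀(X, ℝ)}
    (hf : ∀ n x, f n x ∈ Set.Icc (0 : ℝ) 1)
    (hlim : ∀ x, Tendsto (fun n => f n x) atTop (𝓝 (U.indicator 1 x))) :
    Tendsto (fun n => ∫ x, f n x ∂ν) atTop (𝓝 (ν.real U)) := by
  rw [← integral_indicator_one hU]
  refine tendsto_integral_of_dominated_convergence (fun _ => 1)
    (fun n => (map_continuous (f n)).measurable.aestronglyMeasurable) (integrable_const _)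
    (fun n => Eventually.of_forall fun x => ?_) (Eventually.of_forall hlim)
  rw [Real.norm_of_nonneg (hf n x).1]
  exact (hf n x).2

lemma exists_countable_separating_measures (X : Type*) [TopologicalSpace X] [T2Space X]
    [LocallyCompactSpace X] [SecondCountableTopology X] [MeasurableSpace X] [BorelSpace X] :
    ∃ g : ℕ → C₀(X, ℂ), ∀ ν ν' : Measure X, IsFiniteMeasure ν → IsFiniteMeasure ν' →
      (∀ n, ∫ x, g n x ∂ν = ∫ x, g n x ∂ν') → ν = ν' := by
  obtain ⟨b, hbc, hpi, huniv, hopen, hgen⟩ := exists_countable_isPiSystem_isOpen X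
  choose f hf _ hlim using fun U : b => exists_monotone_tendsto_indicator (hopen U U.2)
  have : Countable b := hbc.to_subtype
  have : Nonempty b := ⟨⟨_, huniv⟩⟩
  obtain ⟨e, he⟩ := exists_surjective_nat (b × ℕ)
  refine ⟨fun n => ofRealC0 (f (e n).1 (e n).2), fun ν ν' hν hν' h => ?_⟩
  have hf_int : ∀ U n, ∫ x, f U n x ∂ν = ∫ x, f U n x ∂ν' := fun U n => by
    obtain ⟨k, hk⟩ := he (U, n)
    have hint := h k
    simp only [hk, ofRealC0_apply, integral_complex_ofReal] at hint
    exact_mod_cast hint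
  have heq : ∀ U ∈ b, ν U = ν' U := fun U hU => by
    have hU' := (hopen U hU).measurableSet
    refine (measureReal_eq_measureReal_iff).1 (tendsto_nhds_unique
      (tendsto_integral_measureReal hU' (hf ⟨U, hU⟩) (hlim ⟨U, hU⟩)) ?_)
    simp only [hf_int]
    exact tendsto_integral_measureReal hU' (hf ⟨U, hU⟩) (hlim ⟨U, hU⟩)
  exact ext_of_generate_finite b ((BorelSpace.measurable_eq (α := X)).trans hgen) hpi heq
    (heq _ huniv)

end Separation

namespace PosBall

variable {Ω : Type*} [MeasurableSpace Ω]

instance isFiniteMeasure (ν : PosBall Ω) : IsFiniteMeasure ν.1 :=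
  ⟨ν.2.trans_lt ENNReal.one_lt_top⟩

variable [TopologicalSpace Ω]

lemma isInducing_pairing : IsInducing fun (ν : PosBall Ω) (f : C₀(Ω, ℂ)) => ν.pairing f := ⟨rfl⟩

lemma continuous_iff {Y : Type*} [TopologicalSpace Y] {μ : Y → PosBall Ω} :
    Continuous μ ↔ ∀ f : C₀(Ω, ℂ), Continuous fun y => (μ y).pairing f :=
  isInducing_pairing.continuous_iff.trans continuous_pi_iff

lemma continuous_pairing (f : C₀(Ω, ℂ)) : Continuous fun ν : PosBall Ω => ν.pairing f :=
  continuous_iff.1 continuous_id f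

instance : MeasurableSpace (PosBall Ω) := borel _

instance : BorelSpace (PosBall Ω) := ⟨rfl⟩

lemma norm_pairing_le (ν : PosBall Ω) (f : C₀(Ω, ℂ)) : ‖ν.pairing f‖ ≤ ‖f‖ := by
  refine (norm_integral_le_of_norm_le_const (Eventually.of_forall (norm_apply_le_norm f))).trans ?_
  exact mul_le_of_le_one_right (norm_nonneg _) (ENNReal.toReal_mono ENNReal.one_ne_top ν.2)

lemma pairing_nonneg (ν : PosBall Ω) {f : C₀(Ω, ℂ)} (hf : ∀ x, 0 ≤ f x) : 0 ≤ ν.pairing f :=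
  integral_nonneg hf

lemma pairing_le_one (ν : PosBall Ω) {f : C₀(Ω, ℂ)} (hf : ∀ x, 0 ≤ f x) (hf1 : ∀ x, f x ≤ 1) :
    ν.pairing f ≤ 1 := by
  have hn : ‖ν.pairing f‖ ≤ 1 * (ν.1 Set.univ).toReal :=
    norm_integral_le_of_norm_le_const (Eventually.of_forall fun x =>
      (CStarAlgebra.norm_le_one_iff_of_nonneg (f x) (hf x)).2 (hf1 x))
  have h1 : (ν.1 Set.univ).toReal ≤ 1 := ENNReal.toReal_mono ENNReal.one_ne_top ν.2
  rw [Complex.eq_coe_norm_of_nonneg (ν.pairing_nonneg hf)]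
  exact_mod_cast hn.trans ((one_mul _).trans_le h1)

variable [BorelSpace Ω] [T2Space Ω] [LocallyCompactSpace Ω]

lemma exists_pairing_eq {Λ : C₀(Ω, ℂ) →ₗ[ℂ] ℂ}
    (hpos : ∀ f : C₀(Ω, ℂ), (∀ x, 0 ≤ f x) → 0 ≤ Λ f)
    (hle : ∀ f : C₀(Ω, ℂ), (∀ x, 0 ≤ f x) → (∀ x, f x ≤ 1) → Λ f ≤ 1) :
    ∃ ν : PosBall Ω, ∀ f, ν.pairing f = Λ f := by
  obtain ⟨ν, hν, h⟩ := rieszMarkovKakutani_complex (C := 1) hpos (by simpa using hle)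
  exact ⟨⟨ν, by simpa using hν⟩, fun f => (h f).symm⟩

/-- The argument is that of the Banach–Alaoglu theorem: in the product of the discs of radius
`‖f‖`, positivity and the bound by one on `0 ≤ f ≤ 1` are closed conditions. -/
instance compactSpace : CompactSpace (PosBall Ω) := by
  let D : Set (C₀(Ω, ℂ) → ℂ) := Set.pi Set.univ fun f => Metric.closedBall 0 ‖f‖
  have hD : IsCompact D := isCompact_univ_pi fun f => isCompact_closedBall 0 ‖f‖
  let R : Set (C₀(Ω, ℂ) → ℂ) := Set.range ((⇑) : (C₀(Ω, ℂ) →ₗ[ℂ] ℂ) → C₀(Ω, ℂ) → ℂ) ∩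
    ⋂ (f : C₀(Ω, ℂ)) (_ : ∀ x, 0 ≤ f x), {φ | 0 ≤ φ f} ∩ {φ | (∀ x, f x ≤ 1) → φ f ≤ 1}
  have hR : IsClosed R := by
    refine (LinearMap.isClosed_range_coe _ _ _).inter (isClosed_iInter fun f =>
      isClosed_iInter fun _ => (isClosed_le continuous_const (continuous_apply f)).inter ?_)
    simp only [Set.ofPred_forall]
    exact isClosed_iInter fun _ => isClosed_le (continuous_apply f) continuous_const
  have hrange : Set.range (fun (ν : PosBall Ω) (f : C₀(Ω, ℂ)) => ν.pairing f) = D ∩ R := by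
    refine Set.Subset.antisymm ?_ ?_
    · rintro _ ⟨ν, rfl⟩
      exact ⟨fun f _ => mem_closedBall_zero_iff.2 (ν.norm_pairing_le f),
        ⟨(integralC0 ℂ ν.1).toLinearMap, rfl⟩,
        Set.mem_iInter₂.2 fun f hf => ⟨ν.pairing_nonneg hf, ν.pairing_le_one hf⟩⟩
    · rintro _ ⟨-, ⟨Λ, rfl⟩, hΛ⟩
      have hΛ := Set.mem_iInter₂.1 hΛ
      obtain ⟨ν, hν⟩ := exists_pairing_eq (fun f hf => (hΛ f hf).1) fun f hf => (hΛ f hf).2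
      exact ⟨ν, funext hν⟩
  refine ⟨isInducing_pairing.isCompact_iff.2 ?_⟩
  rw [Set.image_univ, hrange]
  exact hD.inter_right hR

variable [SecondCountableTopology Ω]

lemma exists_countable_separating (Ω : Type*) [TopologicalSpace Ω] [T2Space Ω]
    [LocallyCompactSpace Ω] [SecondCountableTopology Ω] [MeasurableSpace Ω] [BorelSpace Ω] :
    ∃ g : ℕ → C₀(Ω, ℂ), ∀ ν ν' : PosBall Ω, (∀ n, ν.pairing (g n) = ν'.pairing (g n)) → ν = ν' := by
  obtain ⟨g, hg⟩ := exists_countable_separating_measures Ω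
  exact ⟨g, fun ν ν' h => Subtype.ext (hg ν.1 ν'.1 inferInstance inferInstance h)⟩

lemma ext_pairing {ν ν' : PosBall Ω} (h : ∀ f, ν.pairing f = ν'.pairing f) : ν = ν' := by
  obtain ⟨g, hg⟩ := exists_countable_separating Ω
  exact hg ν ν' fun n => h _

instance t2Space : T2Space (PosBall Ω) :=
  T2Space.of_injective_continuous (fun _ _ h => ext_pairing (congrFun h))
    isInducing_pairing.continuous

instance metrizableSpace : TopologicalSpace.MetrizableSpace (PosBall Ω) := by
  obtain ⟨g, hg⟩ := exists_countable_separating Ω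
  refine Metric.PiNatEmbed.TopologicalSpace.MetrizableSpace.of_countable_separating
    (fun n (ν : PosBall Ω) => ν.pairing (g n)) (fun n => continuous_pairing (g n)) fun ν ν' h => ?_
  by_contra! h'
  exact h (hg _ _ h')

end PosBall

section Effects

variable {X H : Type*} [MeasurableSpace X]

lemma hasSum_measureReal_iUnion (m : Measure X) [IsFiniteMeasure m] {A : ℕ → Set X}
    (hA : ∀ i, MeasurableSet (A i)) (hd : Pairwise (Function.onFun Disjoint A)) :
    HasSum (fun i => m.real (A i)) (m.real (⋃ i, A i)) := by
  simpa only [Measure.toSignedMeasure_apply_measurable, hA, MeasurableSet.iUnion hA]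
    using m.toSignedMeasure.m_iUnion hA hd

variable [NormedAddCommGroup H] [InnerProductSpace ℂ H]

/-- The quadratic form of the operator `T` is the value at `A` of a family `m` of measures
indexed by vectors. If `m` is the family of vector measures of a positive operator valued
measure `P`, then `T` is the effect `P(A)`. -/
def IsEffect (m : H → Measure X) (A : Set X) (T : H →L[ℂ] H) : Prop :=
  ∀ ψ, inner ℂ ψ (T ψ) = ((m ψ).real A : ℂ)

namespace IsEffect

variable {m : H → Measure X} {A : Set X} {T T' : H →L[ℂ] H}

lemma unique (h : IsEffect m A T) (h' : IsEffect m A T') : T = T' :=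
  eq_of_inner_apply_self_eq fun ψ => (h ψ).trans (h' ψ).symm

lemma inner_self_nonneg (h : IsEffect m A T) (ψ : H) : 0 ≤ inner ℂ ψ (T ψ) := by
  rw [h ψ]
  exact Complex.zero_le_real.2 measureReal_nonneg

lemma isPositive (h : IsEffect m A T) : T.IsPositive :=
  isPositive_of_inner_self_nonneg h.inner_self_nonneg

variable [∀ ψ, IsFiniteMeasure (m ψ)]

lemma norm_le_one [CompleteSpace H] (h : IsEffect m A T) (hm : IsEffect m Set.univ 1) :
    ‖T‖ ≤ 1 := by
  refine norm_le_one_of_inner_self_le h.inner_self_nonneg fun ψ => ?_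
  rw [h ψ]
  exact (Complex.real_le_real.2 (measureReal_mono (Set.subset_univ A))).trans_eq (hm ψ).symm

lemma compl (h : IsEffect m A T) (hm : IsEffect m Set.univ 1) (hA : MeasurableSet A) :
    IsEffect m Aᶜ (1 - T) := fun ψ => by
  rw [sub_apply, inner_sub_right, h ψ, hm ψ, measureReal_compl hA, Complex.ofReal_sub]

lemma biUnion {A : ℕ → Set X} (hA : ∀ i, MeasurableSet (A i))
    (hd : Pairwise (Function.onFun Disjoint A)) {T : ℕ → H →L[ℂ] H}
    (h : ∀ i, IsEffect m (A i) (T i)) (s : Finset ℕ) :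
    IsEffect m (⋃ i ∈ s, A i) (∑ i ∈ s, T i) := fun ψ => by
  rw [measureReal_biUnion_finset (fun i _ j _ hij => hd hij) (fun i _ => hA i), sum_apply,
    inner_sum, Complex.ofReal_sum]
  exact Finset.sum_congr rfl fun i _ => h i ψ

lemma hasSum_inner_self {A : ℕ → Set X} (hA : ∀ i, MeasurableSet (A i))
    (hd : Pairwise (Function.onFun Disjoint A)) {T : ℕ → H →L[ℂ] H}
    (h : ∀ i, IsEffect m (A i) (T i)) (ψ : H) :
    HasSum (fun i => inner ℂ ψ (T i ψ)) ((m ψ).real (⋃ i, A i) : ℂ) := by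
  simp only [fun i => h i ψ]
  exact Complex.hasSum_ofReal.2 (hasSum_measureReal_iUnion (m ψ) hA hd)

lemma hasSum_inner {A : ℕ → Set X} (hA : ∀ i, MeasurableSet (A i))
    (hd : Pairwise (Function.onFun Disjoint A)) {T : ℕ → H →L[ℂ] H}
    (h : ∀ i, IsEffect m (A i) (T i)) (h' : IsEffect m (⋃ i, A i) T') (x y : H) :
    HasSum (fun i => inner ℂ x (T i y)) (inner ℂ x (T' y)) := by
  have hlim := tendsto_inner_of_tendsto_inner_self (l := atTop)
    (T := fun s : Finset ℕ => ∑ i ∈ s, T i) (T' := T') (fun ψ => ?_) x y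
  · exact hlim.congr fun s => by rw [sum_apply, inner_sum]
  · rw [h' ψ]
    exact (hasSum_inner_self hA hd h ψ).congr fun s => by rw [sum_apply, inner_sum]

end IsEffect

variable [CompleteSpace H] {m : H → Measure X} [∀ ψ, IsFiniteMeasure (m ψ)]

lemma exists_isEffect_iUnion (hm : IsEffect m Set.univ 1) {A : ℕ → Set X}
    (hA : ∀ i, MeasurableSet (A i)) (hd : Pairwise (Function.onFun Disjoint A))
    {T : ℕ → H →L[ℂ] H} (h : ∀ i, IsEffect m (A i) (T i)) :
    ∃ T', IsEffect m (⋃ i, A i) T' :=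
  exists_inner_self_eq_of_tendsto (C := 1) (l := atTop)
    (T := fun s : Finset ℕ => ∑ i ∈ s, T i)
    (fun s => (IsEffect.biUnion hA hd h s).norm_le_one hm) fun ψ =>
      (IsEffect.hasSum_inner_self hA hd h ψ).congr fun s => by rw [sum_apply, inner_sum]

lemma exists_isEffect {C : Set (Set X)} (hC : ‹MeasurableSpace X› = MeasurableSpace.generateFrom C)
    (hpi : IsPiSystem C) (hm : IsEffect m Set.univ 1) (h : ∀ A ∈ C, ∃ T, IsEffect m A T) :
    ∀ A, MeasurableSet A → ∃ T, IsEffect m A T := by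
  refine MeasurableSpace.induction_on_inter hC hpi ⟨0, fun ψ => by simp⟩ h ?_ ?_
  · rintro A hA ⟨T, hT⟩
    exact ⟨1 - T, hT.compl hm hA⟩
  · intro A hd hA hT
    choose T hT using hT
    exact exists_isEffect_iUnion hm hA hd hT

end Effects

namespace POVM

variable {X H : Type*} [MeasurableSpace X] [NormedAddCommGroup H] [InnerProductSpace ℂ H]
  [CompleteSpace H]

lemma vecMeasure_apply (P : POVM X H) (ψ : H) {A : Set X} (hA : MeasurableSet A) :
    P.vecMeasure ψ A = ENNReal.ofReal (inner ℂ ψ (P.toFun A ψ)).re := by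
  rw [POVM.vecMeasure, Measure.ofMeasurable_apply A hA]

instance isFiniteMeasure_vecMeasure (P : POVM X H) (ψ : H) : IsFiniteMeasure (P.vecMeasure ψ) :=
  ⟨(P.vecMeasure_apply ψ MeasurableSet.univ).trans_lt ENNReal.ofReal_lt_top⟩

lemma isEffect_toFun (P : POVM X H) {A : Set X} (hA : MeasurableSet A) :
    IsEffect P.vecMeasure A (P.toFun A) := fun ψ => by
  have h := (P.isPositive A hA).inner_nonneg_right ψ
  rw [measureReal_def, P.vecMeasure_apply ψ hA,
    ENNReal.toReal_ofReal (Complex.nonneg_iff.1 h).1]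
  exact Complex.eq_re_of_ofReal_le (r := 0) (by simpa using h)

lemma isEffect_univ (P : POVM X H) : IsEffect P.vecMeasure Set.univ 1 :=
  P.univ ▸ P.isEffect_toFun MeasurableSet.univ

lemma inner_toFun_left (P : POVM X H) {A : Set X} (hA : MeasurableSet A) (x y : H) :
    inner ℂ (P.toFun A x) y = inner ℂ x (P.toFun A y) :=
  (P.isPositive A hA).isSymmetric x y

lemma star_toFun (P : POVM X H) {A : Set X} (hA : MeasurableSet A) :
    star (P.toFun A) = P.toFun A :=
  (P.isPositive A hA).isSelfAdjoint

lemma toFun_compl (P : POVM X H) {A : Set X} (hA : MeasurableSet A) :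
    P.toFun Aᶜ = 1 - P.toFun A :=
  (P.isEffect_toFun hA.compl).unique
    ((P.isEffect_toFun hA).compl P.isEffect_univ hA)

lemma toFun_inter_compl (P : POVM X H) {A B : Set X} (hA : MeasurableSet A)
    (hB : MeasurableSet B) : P.toFun (A ∩ Bᶜ) = P.toFun A - P.toFun (A ∩ B) := by
  refine (P.isEffect_toFun (hA.inter hB.compl)).unique fun ψ => ?_
  rw [sub_apply, inner_sub_right, P.isEffect_toFun hA, P.isEffect_toFun (hA.inter hB),
    ← Complex.ofReal_sub, ← measureReal_inter_add_sdiff (s := A) hB, add_sub_cancel_left,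
    Set.sdiff_eq]

theorem exists_vecMeasure_eq {m : H → Measure X} [∀ ψ, IsFiniteMeasure (m ψ)] {C : Set (Set X)}
    (hC : ‹MeasurableSpace X› = MeasurableSpace.generateFrom C) (hpi : IsPiSystem C)
    (hm : IsEffect m Set.univ 1) (h : ∀ A ∈ C, ∃ T, IsEffect m A T) :
    ∃ P : POVM X H, ∀ ψ, P.vecMeasure ψ = m ψ := by
  choose! T hT using exists_isEffect hC hpi hm h
  let P : POVM X H :=
    { toFun := T
      isPositive := fun A hA => (hT A hA).isPositive
      univ := (hT _ MeasurableSet.univ).unique hm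
      hasSum_iUnion := fun A hA hd =>
        IsEffect.hasSum_inner hA hd (fun i => hT _ (hA i)) (hT _ (MeasurableSet.iUnion hA)) }
  refine ⟨P, fun ψ => Measure.ext fun A hA => ?_⟩
  rw [P.vecMeasure_apply ψ hA, show P.toFun A = T A from rfl, hT A hA, Complex.ofReal_re,
    ofReal_measureReal]

variable {C : Set (Set X)}

lemma toFun_mul_eq_of_forall_mem (P : POVM X H)
    (hC : ‹MeasurableSpace X› = MeasurableSpace.generateFrom C) (hpi : IsPiSystem C)
    {B : Set X} (hB : MeasurableSet B)
    (h : ∀ A ∈ C, P.toFun B * P.toFun A = P.toFun (B ∩ A)) :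
    ∀ A, MeasurableSet A → P.toFun B * P.toFun A = P.toFun (B ∩ A) := by
  refine MeasurableSpace.induction_on_inter hC hpi ?_ h ?_ ?_
  · rw [Set.inter_empty, P.toFun_empty, mul_zero]
  · intro A hA ih
    rw [P.toFun_compl hA, mul_sub, mul_one, ih, P.toFun_inter_compl hB hA]
  · intro A hd hA ih
    ext v
    refine ext_inner_left ℂ fun u => ?_
    rw [mul_apply_eq_comp, ← P.inner_toFun_left hB, Set.inter_iUnion]
    refine (P.hasSum_iUnion A hA hd _ v).unique ?_
    refine (P.hasSum_iUnion (fun i => B ∩ A i) (fun i => hB.inter (hA i))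
      (fun i j hij => (hd hij).mono Set.inter_subset_right Set.inter_subset_right) u v).congr
      fun s => Finset.sum_congr rfl fun i _ => ?_
    simp only [← ih i, P.inner_toFun_left hB, mul_apply_eq_comp]

theorem toFun_mul_eq_of_isPiSystem (P : POVM X H)
    (hC : ‹MeasurableSpace X› = MeasurableSpace.generateFrom C) (hpi : IsPiSystem C)
    (h : ∀ A ∈ C, ∀ B ∈ C, P.toFun A * P.toFun B = P.toFun (A ∩ B)) {A B : Set X}
    (hA : MeasurableSet A) (hB : MeasurableSet B) :
    P.toFun A * P.toFun B = P.toFun (A ∩ B) := by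
  have hmeas : ∀ K ∈ C, MeasurableSet K := fun K hK => by
    rw [hC]
    exact MeasurableSpace.measurableSet_generateFrom hK
  refine P.toFun_mul_eq_of_forall_mem hC hpi hA (fun K hK => ?_) B hB
  have hKA := P.toFun_mul_eq_of_forall_mem hC hpi (hmeas K hK) (h K hK) A hA
  have hstar := congrArg star hKA
  rwa [star_mul, P.star_toFun hA, P.star_toFun (hmeas K hK),
    P.star_toFun ((hmeas K hK).inter hA), Set.inter_comm] at hstar

end POVM

section Integral

variable {X H : Type*} [MeasurableSpace X]

lemma tendsto_integral_approxBounded_mul {m : Measure X} {φ g : X → ℂ} (hφ : StronglyMeasurable φ)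
    {C : ℝ} (hC0 : 0 ≤ C) (hC : ∀ x, ‖φ x‖ ≤ C) (hg : Integrable g m) :
    Tendsto (fun n => ∫ x, hφ.approxBounded C n x * g x ∂m) atTop (𝓝 (∫ x, φ x * g x ∂m)) := by
  refine tendsto_integral_of_dominated_convergence (fun x => C * ‖g x‖)
    (fun n => (SimpleFunc.measurable _).aestronglyMeasurable.mul hg.1) (hg.norm.const_mul _)
    (fun n => Eventually.of_forall fun x => ?_)
    (Eventually.of_forall fun x => (hφ.tendsto_approxBounded_of_norm_le (hC x)).mul_const _)
  rw [norm_mul]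
  exact mul_le_mul_of_nonneg_right (hφ.norm_approxBounded_le hC0 n x) (norm_nonneg _)

variable [NormedAddCommGroup H] [InnerProductSpace ℂ H] [CompleteSpace H]

namespace POVM

lemma isIntegral_const (P : POVM X H) (c : ℂ) : P.IsIntegral (fun _ => c) (c • 1) := fun ψ => by
  rw [integral_const, Complex.real_smul, smul_apply, inner_smul_right, P.isEffect_univ, mul_comm]

namespace IsIntegral

variable {P : POVM X H} {φ φ' : X → ℂ} {T T' : H →L[ℂ] H}

lemma unique (h : P.IsIntegral φ T) (h' : P.IsIntegral φ T') : T = T' :=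
  eq_of_inner_apply_self_eq fun ψ => (h ψ).trans (h' ψ).symm

lemma star (h : P.IsIntegral φ T) : P.IsIntegral (star φ) (star T) := fun ψ => by
  rw [ContinuousLinearMap.star_eq_adjoint, ContinuousLinearMap.adjoint_inner_right,
    ← inner_conj_symm, h ψ, ← integral_conj]
  rfl

lemma add (h : P.IsIntegral φ T) (h' : P.IsIntegral φ' T')
    (hφ : ∀ ψ, Integrable φ (P.vecMeasure ψ)) (hφ' : ∀ ψ, Integrable φ' (P.vecMeasure ψ)) :
    P.IsIntegral (φ + φ') (T + T') := fun ψ => by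
  rw [add_apply, inner_add_right, h ψ, h' ψ, ← integral_add (hφ ψ) (hφ' ψ)]
  rfl

lemma const_smul (h : P.IsIntegral φ T) (c : ℂ) : P.IsIntegral (c • φ) (c • T) := fun ψ => by
  rw [smul_apply, inner_smul_right, h ψ, ← integral_const_mul]
  rfl

end IsIntegral

end POVM

namespace PVM

variable (P : PVM X H) {A B : Set X}

lemma toFun_mul_self (hA : MeasurableSet A) : P.toFun A * P.toFun A = P.toFun A := by
  rw [P.mul_eq A A hA hA, Set.inter_self]

lemma toFun_mul_comm (hA : MeasurableSet A) (hB : MeasurableSet B) :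
    P.toFun A * P.toFun B = P.toFun B * P.toFun A := by
  rw [P.mul_eq A B hA hB, P.mul_eq B A hB hA, Set.inter_comm]

lemma vecMeasure_toFun (hA : MeasurableSet A) (ψ : H) :
    P.vecMeasure (P.toFun A ψ) = (P.vecMeasure ψ).restrict A := by
  ext B hB
  rw [Measure.restrict_apply hB, P.vecMeasure_apply _ hB, P.vecMeasure_apply _ (hB.inter hA),
    P.inner_toFun_left hA, ← mul_apply_eq_comp, ← mul_apply_eq_comp, mul_assoc,
    P.mul_eq B A hB hA, P.mul_eq A _ hA (hB.inter hA), Set.inter_left_comm, Set.inter_self]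

/-- The self-adjoint unitary `2 P(A) - 1`, which reflects in the range of `P(A)`. -/
def reflection (A : Set X) : H →L[ℂ] H := (2 : ℂ) • P.toFun A - 1

lemma reflection_mul_self (hA : MeasurableSet A) : P.reflection A * P.reflection A = 1 := by
  rw [reflection, sub_mul, mul_sub, smul_mul_smul_comm, P.toFun_mul_self hA]
  simp only [mul_one, one_mul]
  module

lemma inner_reflection_left (hA : MeasurableSet A) (x y : H) :
    inner ℂ (P.reflection A x) y = inner ℂ x (P.reflection A y) := by
  simp only [reflection, sub_apply, smul_apply, one_apply_eq_self, inner_sub_left,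
    inner_sub_right, inner_smul_left, inner_smul_right, P.inner_toFun_left hA,
    Complex.conj_ofNat]

lemma vecMeasure_reflection (hA : MeasurableSet A) (ψ : H) :
    P.vecMeasure (P.reflection A ψ) = P.vecMeasure ψ := by
  ext B hB
  have hcomm : P.toFun B * P.reflection A = P.reflection A * P.toFun B := by
    rw [reflection, mul_sub, sub_mul, mul_one, one_mul, mul_smul_comm, smul_mul_assoc,
      P.toFun_mul_comm hA hB]
  rw [P.vecMeasure_apply _ hB, P.vecMeasure_apply _ hB, P.inner_reflection_left hA,
    ← mul_apply_eq_comp, ← mul_apply_eq_comp, mul_assoc, hcomm, ← mul_assoc,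
    P.reflection_mul_self hA, one_mul]

end PVM

namespace POVM.IsIntegral

variable {P : PVM X H} {φ φ' : X → ℂ} {T T' : H →L[ℂ] H} {A : Set X}

/-- The vector measures, hence the integral, are invariant under the reflection in `P(A)`. -/
lemma commute_toFun (h : P.IsIntegral φ T) (hA : MeasurableSet A) : Commute (P.toFun A) T := by
  have hconj : P.reflection A * T * P.reflection A = T := eq_of_inner_apply_self_eq fun ψ => by
    rw [mul_apply_eq_comp, mul_apply_eq_comp, ← P.inner_reflection_left hA, h, h,
      P.vecMeasure_reflection hA]
  have hcomm : P.reflection A * T = T * P.reflection A := by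
    rw [← mul_one (P.reflection A * T), ← P.reflection_mul_self hA, ← mul_assoc, hconj]
  rw [PVM.reflection, sub_mul, mul_sub, mul_one, one_mul, mul_smul_comm, smul_mul_assoc,
    sub_left_inj] at hcomm
  exact smul_right_injective _ two_ne_zero hcomm

lemma indicator (h : P.IsIntegral φ T) (hA : MeasurableSet A) :
    P.IsIntegral (A.indicator φ) (P.toFun A * T) := fun ψ => by
  rw [← P.toFun_mul_self hA, mul_assoc, (h.commute_toFun hA).eq, mul_apply_eq_comp,
    mul_apply_eq_comp, ← P.inner_toFun_left hA, h, P.vecMeasure_toFun hA,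
    integral_indicator hA]

lemma exists_simpleFunc_mul (P : PVM X H) (s : SimpleFunc X ℂ) :
    ∃ S : H →L[ℂ] H, ∀ (φ : X → ℂ) (T : H →L[ℂ] H), (∀ ψ, Integrable φ (P.vecMeasure ψ)) →
      P.IsIntegral φ T → P.IsIntegral (⇑s * φ) (S * T) := by
  induction s using SimpleFunc.induction with
  | @const c A hA =>
    refine ⟨c • P.toFun A, fun φ T _ h => ?_⟩
    rw [smul_mul_assoc]
    convert (h.indicator hA).const_smul c using 1
    ext x
    by_cases hx : x ∈ A <;> simp [hx]
  | @add f g _ hf hg =>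
    obtain ⟨S, hS⟩ := hf
    obtain ⟨R, hR⟩ := hg
    have hint : ∀ (s : SimpleFunc X ℂ) (φ : X → ℂ), (∀ ψ, Integrable φ (P.vecMeasure ψ)) →
        ∀ ψ, Integrable (⇑s * φ) (P.vecMeasure ψ) := fun s φ hφ ψ => by
      obtain ⟨C, hC⟩ := s.exists_forall_norm_le
      exact (hφ ψ).bdd_mul s.measurable.aestronglyMeasurable (Eventually.of_forall hC)
    refine ⟨S + R, fun φ T hφ h => ?_⟩
    rw [SimpleFunc.coe_add, add_mul, add_mul]
    exact (hS φ T hφ h).add (hR φ T hφ h) (hint f φ hφ) (hint g φ hφ)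

theorem mul (h : P.IsIntegral φ T) (h' : P.IsIntegral φ' T') {C : ℝ} (hφ : Measurable φ)
    (hC : ∀ x, ‖φ x‖ ≤ C) (hφ' : ∀ ψ, Integrable φ' (P.vecMeasure ψ)) :
    P.IsIntegral (φ * φ') (T * T') := by
  wlog hC0 : 0 ≤ C generalizing C
  · exact this (fun x => (hC x).trans (le_max_left C 0)) (le_max_right C 0)
  choose S hS using fun n => exists_simpleFunc_mul P (hφ.stronglyMeasurable.approxBounded C n)
  have hST : ∀ x y, Tendsto (fun n => inner ℂ x (S n y)) atTop (𝓝 (inner ℂ x (T y))) :=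
    tendsto_inner_of_tendsto_inner_self fun ψ => by
      have hlim := tendsto_integral_approxBounded_mul hφ.stronglyMeasurable hC0 hC
        (integrable_const (1 : ℂ) (μ := P.vecMeasure ψ))
      simp only [mul_one, ← h ψ] at hlim
      refine hlim.congr fun n => ?_
      have hS1 := hS n _ _ (fun _ => integrable_const _) (P.isIntegral_const 1) ψ
      simpa using hS1.symm
  exact fun ψ => tendsto_nhds_unique (hST ψ (T' ψ))
    ((tendsto_integral_approxBounded_mul hφ.stronglyMeasurable hC0 hC (hφ' ψ)).congr fun n =>
      (hS n φ' T' hφ' h' ψ).symm)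

end POVM.IsIntegral

end Integral

section ContinuousMap

variable {X : Type*} [TopologicalSpace X] [CompactSpace X] [MeasurableSpace X]
  [OpensMeasurableSpace X]

lemma integrable_continuousMap (g : C(X, ℂ)) (m : Measure X) [IsFiniteMeasure m] :
    Integrable g m :=
  g.continuous.integrable_of_hasCompactSupport (.of_compactSpace g)

lemma continuous_integral_continuousMap (m : Measure X) [IsFiniteMeasure m] :
    Continuous fun g : C(X, ℂ) => ∫ x, g x ∂m := by
  refine (LipschitzWith.of_dist_le_mul (K := (m.real Set.univ).toNNReal) fun f g => ?_).continuous
  rw [dist_eq_norm, dist_eq_norm,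
    ← integral_sub (integrable_continuousMap f m) (integrable_continuousMap g m),
    Real.coe_toNNReal _ measureReal_nonneg, mul_comm]
  exact norm_integral_le_of_norm_le_const (Eventually.of_forall (f - g).norm_coe_le_norm)

end ContinuousMap

section OuterApproximation

variable {X : Type*} [TopologicalSpace X] [HasOuterApproxClosed X] {K : Set X}

/-- The decreasing sequence of continuous functions approximating the indicator of a closed
set, with complex values. -/
def closedApprox (hK : IsClosed K) (n : ℕ) : C(X, ℂ) :=
  ⟨fun x => ((hK.apprSeq n x : ℝ) : ℂ), by fun_prop⟩

lemma norm_closedApprox_le (hK : IsClosed K) (n : ℕ) (x : X) : ‖closedApprox hK n x‖ ≤ 1 := by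
  simp only [closedApprox, ContinuousMap.coe_mk, Complex.norm_real, NNReal.norm_eq]
  exact_mod_cast HasOuterApproxClosed.apprSeq_apply_le_one hK n x

lemma tendsto_closedApprox (hK : IsClosed K) (x : X) :
    Tendsto (fun n => closedApprox hK n x) atTop (𝓝 (K.indicator 1 x)) := by
  have h := tendsto_pi_nhds.1 (HasOuterApproxClosed.tendsto_apprSeq hK) x
  have hcoe : Continuous fun t : NNReal => ((t : ℝ) : ℂ) := by fun_prop
  convert! (hcoe.tendsto _).comp h using 2
  by_cases hx : x ∈ K <;> simp [hx]

lemma tendsto_integral_closedApprox_mul [MeasurableSpace X] [BorelSpace X] (hK : IsClosed K)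
    {m : Measure X} {g : X → ℂ} (hg : Integrable g m) :
    Tendsto (fun n => ∫ x, closedApprox hK n x * g x ∂m) atTop (𝓝 (∫ x in K, g x ∂m)) := by
  rw [← integral_indicator hK.measurableSet]
  refine tendsto_integral_of_dominated_convergence (fun x => ‖g x‖)
    (fun n => (closedApprox hK n).continuous.measurable.aestronglyMeasurable.mul hg.1) hg.norm
    (fun n => Eventually.of_forall fun x => ?_) (Eventually.of_forall fun x => ?_)
  · rw [norm_mul]
    exact mul_le_of_le_one_left (norm_nonneg _) (norm_closedApprox_le hK n x)
  · convert (tendsto_closedApprox hK x).mul_const (g x) using 2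
    by_cases hx : x ∈ K <;> simp [hx]

end OuterApproximation

section SpectralTheorem

variable {H : Type*} [NormedAddCommGroup H] [InnerProductSpace ℂ H]

lemma inner_apply_self_mono {T T' : H →L[ℂ] H} (h : T ≤ T') (ψ : H) :
    inner ℂ ψ (T ψ) ≤ inner ℂ ψ (T' ψ) := by
  rw [← sub_nonneg, ← inner_sub_right, ← sub_apply]
  exact ((ContinuousLinearMap.le_def T T').1 h).inner_nonneg_right ψ

variable {X : Type*} [TopologicalSpace X] [MeasurableSpace X] [BorelSpace X] [CompleteSpace H]

section

variable [HasOuterApproxClosed X] {π : C(X, ℂ) →⋆ₐ[ℂ] (H →L[ℂ] H)} {m : H → Measure X}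
  [∀ ψ, IsFiniteMeasure (m ψ)] (hm : ∀ ψ (g : C(X, ℂ)), inner ℂ ψ (π g ψ) = ∫ x, g x ∂(m ψ))
  {K L : Set X} {S T : H →L[ℂ] H}
include hm

lemma tendsto_inner_closedApprox_measureReal (hK : IsClosed K) (ψ : H) :
    Tendsto (fun n => inner ℂ ψ (π (closedApprox hK n) ψ)) atTop (𝓝 ((m ψ).real K : ℂ)) := by
  simpa [hm] using tendsto_integral_closedApprox_mul hK (integrable_const (1 : ℂ) (μ := m ψ))

lemma IsEffect.tendsto_inner_closedApprox (hK : IsClosed K) (hT : IsEffect m K T) (x y : H) :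
    Tendsto (fun n => inner ℂ x (π (closedApprox hK n) y)) atTop (𝓝 (inner ℂ x (T y))) := by
  refine tendsto_inner_of_tendsto_inner_self (fun ψ => ?_) x y
  rw [hT]
  exact tendsto_inner_closedApprox_measureReal hm hK ψ

variable [CompactSpace X]

lemma exists_isEffect_of_isClosed (hK : IsClosed K) : ∃ T, IsEffect m K T := by
  refine exists_inner_self_eq_of_tendsto (C := 1) (fun n => ?_)
    (tendsto_inner_closedApprox_measureReal hm hK)
  refine (NonUnitalStarAlgHom.norm_apply_le π _).trans ?_
  exact (ContinuousMap.norm_le _ zero_le_one).2 (norm_closedApprox_le hK n)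

lemma IsEffect.inner_starAlgHom_apply_of_isClosed (hL : IsClosed L) (hT : IsEffect m L T)
    (g : C(X, ℂ)) (ψ : H) : inner ℂ ψ (π g (T ψ)) = ∫ x in L, g x ∂(m ψ) := by
  have hlim := hT.tendsto_inner_closedApprox hm hL ((π g).adjoint ψ) ψ
  simp only [ContinuousLinearMap.adjoint_inner_left] at hlim
  refine tendsto_nhds_unique hlim
    ((tendsto_integral_closedApprox_mul hL (integrable_continuousMap g _)).congr fun n => ?_)
  rw [← mul_apply_eq_comp, ← map_mul, hm]
  simp only [ContinuousMap.mul_apply, mul_comm]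

lemma IsEffect.mul_of_isClosed (hK : IsClosed K) (hL : IsClosed L) (hS : IsEffect m K S)
    (hT : IsEffect m L T) : IsEffect m (K ∩ L) (S * T) := fun ψ => by
  refine tendsto_nhds_unique (hS.tendsto_inner_closedApprox hm hK ψ (T ψ)) ?_
  simp only [hT.inner_starAlgHom_apply_of_isClosed hm hL]
  simpa [measureReal_def, Measure.restrict_apply hK.measurableSet] using
    tendsto_integral_closedApprox_mul hK (integrable_const (1 : ℂ) (μ := (m ψ).restrict L))

end

variable [CompactSpace X] [T2Space X]

lemma exists_measure_inner_starAlgHom (π : C(X, ℂ) →⋆ₐ[ℂ] (H →L[ℂ] H)) (ψ : H) :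
    ∃ m : Measure X, IsFiniteMeasure m ∧ ∀ g : C(X, ℂ), inner ℂ ψ (π g ψ) = ∫ x, g x ∂m := by
  let Λ : C₀(X, ℂ) →ₗ[ℂ] ℂ :=
    { toFun := fun f => inner ℂ ψ (π f.toContinuousMap ψ)
      map_add' := fun f g => by
        rw [show (f + g).toContinuousMap = f.toContinuousMap + g.toContinuousMap from rfl,
          map_add, add_apply, inner_add_right]
      map_smul' := fun c f => by
        rw [show (c • f).toContinuousMap = c • f.toContinuousMap from rfl,
          map_smul, smul_apply, inner_smul_right]
        rfl }
  have hpos : ∀ f : C₀(X, ℂ), (∀ x, 0 ≤ f x) → 0 ≤ Λ f := fun f hf => by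
    have h : 0 ≤ π f.toContinuousMap := map_nonneg π (ContinuousMap.le_def.2 hf)
    simpa [Λ] using inner_apply_self_mono h ψ
  have hle : ∀ f : C₀(X, ℂ), (∀ x, 0 ≤ f x) → (∀ x, f x ≤ 1) → Λ f ≤ (‖ψ‖ ^ 2 : ℝ) :=
    fun f _ hf1 => by
      have h : π f.toContinuousMap ≤ π 1 := OrderHomClass.mono π (ContinuousMap.le_def.2 hf1)
      simpa [Λ] using inner_apply_self_mono h ψ
  obtain ⟨m, hm, hΛ⟩ := rieszMarkovKakutani_complex hpos hle
  exact ⟨m, ⟨hm.trans_lt ENNReal.ofReal_lt_top⟩,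
    fun g => hΛ (ZeroAtInftyContinuousMap.ContinuousMap.liftZeroAtInfty g)⟩

theorem exists_PVM_isIntegral_starAlgHom [HasOuterApproxClosed X]
    (π : C(X, ℂ) →⋆ₐ[ℂ] (H →L[ℂ] H)) :
    ∃ P : PVM X H, ∀ g : C(X, ℂ), P.IsIntegral g (π g) := by
  choose m hfin hm using exists_measure_inner_starAlgHom π
  have huniv : IsEffect m Set.univ 1 := fun ψ => by simpa using hm ψ 1
  have hgen := (BorelSpace.measurable_eq (α := X)).trans borel_eq_generateFrom_isClosed
  obtain ⟨P, hP⟩ := POVM.exists_vecMeasure_eq hgen isPiSystem_isClosed huniv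
    fun K hK => exists_isEffect_of_isClosed hm hK
  have heffect : ∀ A, MeasurableSet A → IsEffect m A (P.toFun A) := fun A hA =>
    funext hP ▸ P.isEffect_toFun hA
  have hmul : ∀ K ∈ {K : Set X | IsClosed K}, ∀ L ∈ {K : Set X | IsClosed K},
      P.toFun K * P.toFun L = P.toFun (K ∩ L) := fun K hK L hL =>
    ((heffect K hK.measurableSet).mul_of_isClosed hm hK hL (heffect L hL.measurableSet)).unique
      (heffect _ (hK.inter hL).measurableSet)
  exact ⟨⟨P, fun A B => P.toFun_mul_eq_of_isPiSystem hgen isPiSystem_isClosed hmul⟩,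
    fun g ψ => (hm ψ g).trans (by rw [← hP ψ])⟩

end SpectralTheorem

section Uniqueness

namespace PVM

variable {X Y H : Type*} [MeasurableSpace X] [MeasurableSpace Y] [NormedAddCommGroup H]
  [InnerProductSpace ℂ H] [CompleteSpace H] (P : PVM X H) {a : X → Y}

/-- The image of a projection valued measure under a measurable map. -/
def map (ha : Measurable a) : PVM Y H where
  toFun B := P.toFun (a ⁻¹' B)
  isPositive B hB := P.isPositive _ (ha hB)
  univ := P.univ
  hasSum_iUnion A hA hd u v := by
    rw [Set.preimage_iUnion]
    exact P.hasSum_iUnion _ (fun i => ha (hA i)) (fun i j hij => (hd hij).preimage a) u v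
  mul_eq A B hA hB := P.mul_eq _ _ (ha hA) (ha hB)

lemma vecMeasure_map (ha : Measurable a) (ψ : H) :
    (P.map ha).vecMeasure ψ = (P.vecMeasure ψ).map a := by
  ext B hB
  rw [Measure.map_apply ha hB, POVM.vecMeasure_apply _ _ hB, POVM.vecMeasure_apply _ _ (ha hB)]
  rfl

lemma isIntegral_map_iff (ha : Measurable a) {g : Y → ℂ} (hg : Measurable g) {T : H →L[ℂ] H} :
    (P.map ha).IsIntegral g T ↔ P.IsIntegral (g ∘ a) T := by
  simp only [POVM.IsIntegral, vecMeasure_map, Function.comp_apply,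
    integral_map ha.aemeasurable hg.aestronglyMeasurable]

lemma support_map [TopologicalSpace X] [TopologicalSpace Y] (hP : P.support = Set.univ)
    (ha : Measurable a) (ha' : Continuous a) : (P.map ha).support = closure (Set.range a) := by
  ext y
  rw [mem_closure_iff]
  refine forall₃_congr fun U hU _ => ⟨fun h0 => ?_, ?_⟩
  · by_contra hne
    rw [← Set.not_disjoint_iff_nonempty_inter, not_not, ← Set.preimage_eq_empty_iff] at hne
    exact h0 ((congrArg P.toFun hne).trans P.toFun_empty)
  · rintro ⟨_, hx, x, rfl⟩
    exact (hP ▸ Set.mem_univ x : x ∈ P.support) _ (hU.preimage ha') hx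

end PVM

variable {X H : Type*} [TopologicalSpace X] [CompactSpace X] [MeasurableSpace X]
  [NormedAddCommGroup H] [InnerProductSpace ℂ H] [CompleteSpace H]

namespace PVM

variable (P Q : PVM X H)

/-- The algebra of the continuous functions having the same integral with respect to two
projection valued measures. It is an algebra because the integral is multiplicative. -/
def commonIntegrals [OpensMeasurableSpace X] : StarSubalgebra ℂ C(X, ℂ) where
  carrier := {g | ∃ T, P.IsIntegral g T ∧ Q.IsIntegral g T}
  mul_mem' := by
    rintro f g ⟨T, hT, hT'⟩ ⟨R, hR, hR'⟩
    exact ⟨T * R,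
      hT.mul hR f.continuous.measurable f.norm_coe_le_norm fun ψ => integrable_continuousMap g _,
      hT'.mul hR' f.continuous.measurable f.norm_coe_le_norm fun ψ => integrable_continuousMap g _⟩
  add_mem' := by
    rintro f g ⟨T, hT, hT'⟩ ⟨R, hR, hR'⟩
    exact ⟨T + R,
      hT.add hR (fun ψ => integrable_continuousMap f _) fun ψ => integrable_continuousMap g _,
      hT'.add hR' (fun ψ => integrable_continuousMap f _) fun ψ => integrable_continuousMap g _⟩
  algebraMap_mem' c := ⟨c • 1, P.isIntegral_const c, Q.isIntegral_const c⟩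
  star_mem' := by
    rintro f ⟨T, hT, hT'⟩
    exact ⟨star T, hT.star, hT'.star⟩

variable {P Q}

lemma vecMeasure_eq_of_separatesPoints [HasOuterApproxClosed X] [BorelSpace X]
    (h : (P.commonIntegrals Q).SeparatesPoints) (ψ : H) : P.vecMeasure ψ = Q.vecMeasure ψ := by
  have hdense : closure (P.commonIntegrals Q : Set C(X, ℂ)) = Set.univ := by
    rw [← StarSubalgebra.topologicalClosure_coe,
      ContinuousMap.starSubalgebra_topologicalClosure_eq_top_of_separatesPoints _ h]
    rfl
  have hsub : (P.commonIntegrals Q : Set C(X, ℂ)) ⊆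
      {g | ∫ x, g x ∂(P.vecMeasure ψ) = ∫ x, g x ∂(Q.vecMeasure ψ)} := by
    rintro g ⟨T, hT, hT'⟩
    exact (hT ψ).symm.trans (hT' ψ)
  have hall (g : C(X, ℂ)) : ∫ x, g x ∂(P.vecMeasure ψ) = ∫ x, g x ∂(Q.vecMeasure ψ) :=
    closure_minimal hsub (isClosed_eq (continuous_integral_continuousMap _)
      (continuous_integral_continuousMap _)) (hdense ▸ Set.mem_univ g)
  refine ext_of_forall_integral_eq_of_IsFiniteMeasure fun f => ?_
  have hf := hall ⟨fun x => (f x : ℂ), by fun_prop⟩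
  simp only [ContinuousMap.coe_mk, integral_complex_ofReal] at hf
  exact_mod_cast hf

lemma toFun_eq_of_separatesPoints [HasOuterApproxClosed X] [BorelSpace X]
    (h : (P.commonIntegrals Q).SeparatesPoints) {A : Set X} (hA : MeasurableSet A) :
    P.toFun A = Q.toFun A := by
  refine (P.isEffect_toFun hA).unique ?_
  rw [funext (vecMeasure_eq_of_separatesPoints h)]
  exact Q.isEffect_toFun hA

end PVM

end Uniqueness

section UniquenessOfRepresentation

lemma exists_homeomorph_of_range_eq {X Y Z : Type*} [TopologicalSpace X] [TopologicalSpace Y]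
    [TopologicalSpace Z] {f : X → Z} {g : Y → Z} (hf : IsEmbedding f) (hg : IsEmbedding g)
    (h : Set.range f = Set.range g) : ∃ Φ : X ≃ₜ Y, f = g ∘ Φ := by
  refine ⟨hf.toHomeomorph.trans ((Homeomorph.setCongr h).trans hg.toHomeomorph.symm), ?_⟩
  funext x
  exact (congrArg Subtype.val (hg.toHomeomorph.apply_symm_apply
    (Homeomorph.setCongr h (hf.toHomeomorph x)))).symm

variable {Ω S S' H : Type*} [TopologicalSpace Ω] [T2Space Ω] [LocallyCompactSpace Ω]
  [SecondCountableTopology Ω] [MeasurableSpace Ω] [BorelSpace Ω]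
  [TopologicalSpace S] [MeasurableSpace S] [TopologicalSpace S'] [MeasurableSpace S']
  [NormedAddCommGroup H] [InnerProductSpace ℂ H] [CompleteSpace H]

namespace FunctionalPOVM.IsRepresentation

variable {E : FunctionalPOVM Ω H} {P : PVM S H} {μ : S → PosBall Ω} {P' : PVM S' H}
  {μ' : S' → PosBall Ω}

lemma isClosedEmbedding [CompactSpace S] (h : E.IsRepresentation P μ) : IsClosedEmbedding μ :=
  h.continuous.isClosedEmbedding h.injective

section

variable [OpensMeasurableSpace S] [OpensMeasurableSpace S']

lemma separatesPoints_commonIntegrals_map (h : E.IsRepresentation P μ)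
    (h' : E.IsRepresentation P' μ') :
    ((P.map h.continuous.measurable).commonIntegrals
      (P'.map h'.continuous.measurable)).SeparatesPoints := fun ν ν' hne => by
  by_contra! hsep
  refine hne (PosBall.ext_pairing fun f => ?_)
  have hf := (PosBall.continuous_pairing (Ω := Ω) f).measurable
  exact hsep _ ⟨⟨_, PosBall.continuous_pairing f⟩, ⟨E.toLinearMap f,
    (P.isIntegral_map_iff _ hf).2 (h.isIntegral f),
    (P'.isIntegral_map_iff _ hf).2 (h'.isIntegral f)⟩, rfl⟩

lemma toFun_preimage_eq (h : E.IsRepresentation P μ) (h' : E.IsRepresentation P' μ')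
    {B : Set (PosBall Ω)} (hB : MeasurableSet B) : P.toFun (μ ⁻¹' B) = P'.toFun (μ' ⁻¹' B) :=
  PVM.toFun_eq_of_separatesPoints (h.separatesPoints_commonIntegrals_map h') hB

lemma support_map [CompactSpace S] (h : E.IsRepresentation P μ) :
    (P.map h.continuous.measurable).support = Set.range μ := by
  rw [P.support_map h.support_eq _ h.continuous, h.isClosedEmbedding.isClosed_range.closure_eq]

lemma range_eq [CompactSpace S] [CompactSpace S'] (h : E.IsRepresentation P μ)
    (h' : E.IsRepresentation P' μ') : Set.range μ = Set.range μ' := by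
  rw [← h.support_map, ← h'.support_map]
  ext ν
  refine forall₃_congr fun U hU _ => not_congr ?_
  exact (h.toFun_preimage_eq h' hU.measurableSet).congr_left

end

theorem exists_homeomorph [CompactSpace S] [OpensMeasurableSpace S] [CompactSpace S']
    [BorelSpace S'] (h : E.IsRepresentation P μ) (h' : E.IsRepresentation P' μ') :
    ∃ Φ : S ≃ₜ S',
      (∀ A : Set S', MeasurableSet A → P'.toFun A = P.toFun (Φ ⁻¹' A)) ∧ μ = μ' ∘ Φ := by
  obtain ⟨Φ, hΦ⟩ := exists_homeomorph_of_range_eq h.isClosedEmbedding.isEmbedding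
    h'.isClosedEmbedding.isEmbedding (h.range_eq h')
  refine ⟨Φ, fun A hA => ?_, hΦ⟩
  have hA' : MeasurableSet (μ' '' A) :=
    h'.isClosedEmbedding.measurableEmbedding.measurableSet_image.2 hA
  have hmap := h.toFun_preimage_eq h' hA'
  rw [hΦ, Set.preimage_comp, h'.injective.preimage_image] at hmap
  exact hmap.symm

end FunctionalPOVM.IsRepresentation

end UniquenessOfRepresentation

section Gelfand

open WeakDual

variable {A : Type*} [CStarAlgebra A] {M : StarSubalgebra ℂ A} [IsClosed (M : Set A)]

lemma characterSpace_apply_nonneg [PartialOrder A] [StarOrderedRing A] (χ : characterSpace ℂ M)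
    {a : M} (ha : 0 ≤ (a : A)) : 0 ≤ χ a := by
  have h : χ a ∈ spectrum ℂ a := AlgHom.apply_mem_spectrum χ a
  rw [StarSubalgebra.spectrum_eq (S := M)] at h
  exact spectrum_nonneg_of_nonneg ha h

/-- `π` is the inverse of the Gelfand transform of `M`, restricted to the functions that factor
through the quotient `X` of the character space. -/
lemma exists_injective_starAlgHom_of_surjective (hcomm : ∀ a ∈ M, ∀ b ∈ M, a * b = b * a)
    {X : Type*} [TopologicalSpace X] {m : C(characterSpace ℂ M, X)} (hm : Function.Surjective m) :
    ∃ π : C(X, ℂ) →⋆ₐ[ℂ] A, Function.Injective π ∧ (∀ g, π g ∈ M) ∧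
      ∀ (a : M) (g : C(X, ℂ)), (∀ χ, g (m χ) = χ a) → π g = a := by
  let _ : CommCStarAlgebra M := { mul_comm := fun a b => Subtype.ext (hcomm a a.2 b b.2) }
  let Γ := gelfandStarTransform M
  let π : C(X, ℂ) →⋆ₐ[ℂ] A :=
    M.subtype.comp ((Γ.symm : _ →⋆ₐ[ℂ] M).comp (m.compStarAlgHom' ℂ ℂ))
  have hπ (g : C(X, ℂ)) : π g = Γ.symm (g.comp m) := rfl
  refine ⟨π, fun g g' h => ?_, fun g => Subtype.prop _, fun a g h => ?_⟩
  · have hcomp : g.comp m = g'.comp m := Γ.symm.injective (Subtype.ext h)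
    ext x
    obtain ⟨χ, rfl⟩ := hm x
    exact DFunLike.congr_fun hcomp χ
  · have hcomp : g.comp m = Γ a := ContinuousMap.ext h
    rw [hπ, hcomp, Γ.symm_apply_apply]

end Gelfand

section Existence

namespace POVM

variable {X H : Type*} [TopologicalSpace X] [MeasurableSpace X] [NormedAddCommGroup H]
  [InnerProductSpace ℂ H] [CompleteSpace H] {P : POVM X H}

lemma support_eq_univ [OpensMeasurableSpace X] [NormalSpace X] [T1Space X]
    (h : ∀ g : C(X, ℂ), P.IsIntegral g 0 → g = 0) : P.support = Set.univ := by
  refine Set.eq_univ_of_forall fun x U hU hx h0 => ?_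
  obtain ⟨g, hg0, hg1, -⟩ := exists_continuous_zero_one_of_isClosed hU.isClosed_compl
    (isClosed_singleton (x := x)) (by simpa using hx)
  let g' : C(X, ℂ) := ⟨fun y => (g y : ℂ), by fun_prop⟩
  have hg' : P.IsIntegral g' 0 := fun ψ => by
    have hU0 : P.vecMeasure ψ U = 0 := by simp [P.vecMeasure_apply ψ hU.measurableSet, h0]
    rw [zero_apply, inner_zero_right, integral_eq_zero_of_ae]
    filter_upwards [measure_eq_zero_iff_ae_notMem.1 hU0] with y hy
    simp [g', hg0 hy]
  simpa [g', hg1 rfl] using DFunLike.congr_fun (h g' hg') x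

lemma commutant_eq_centralizer_range [CompactSpace X] {π : C(X, ℂ) → (H →L[ℂ] H)}
    (hπ : ∀ g : C(X, ℂ), P.IsIntegral g (π g)) :
    P.commutant = Set.centralizer (Set.range π) := by
  unfold commutant
  congr 1 with T
  constructor
  · rintro ⟨φ, hφ⟩
    exact ⟨φ.toContinuousMap, (hπ φ.toContinuousMap).unique hφ⟩
  · rintro ⟨g, rfl⟩
    exact ⟨ZeroAtInftyContinuousMap.ContinuousMap.liftZeroAtInfty g, hπ g⟩

end POVM

namespace FunctionalPOVM

variable {Ω H : Type*} [TopologicalSpace Ω] [NormedAddCommGroup H] [InnerProductSpace ℂ H]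
  [CompleteSpace H] (E : FunctionalPOVM Ω H)

lemma map_star (f : C₀(Ω, ℂ)) : E.toLinearMap (star f) = star (E.toLinearMap f) := by
  have hf : f ∈ Submodule.span ℂ {f : C₀(Ω, ℂ) | ∀ x, 0 ≤ f x} := by simp [span_nonneg_eq_top]
  induction hf using Submodule.span_induction with
  | mem f hf =>
    rw [(E.isPositive f hf).isSelfAdjoint.star_eq]
    refine congrArg _ (ZeroAtInftyContinuousMap.ext fun x => ?_)
    exact (IsSelfAdjoint.of_nonneg (hf x)).star_eq
  | zero => simp
  | add f g _ _ hf hg => simp only [star_add, map_add, hf, hg]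
  | smul c f _ hf => simp only [star_smul, map_smul, hf]

/-- If `0 ≤ gₙ ↑ 1`, then `f ≤ gₙ + f (1 - gₙ) ↑ 1`, so that `E(f)` is below the limit `I`. -/
lemma map_le_one [T2Space Ω] [LocallyCompactSpace Ω] [SecondCountableTopology Ω] {f : C₀(Ω, ℂ)}
    (hf0 : ∀ x, 0 ≤ f x) (hf1 : ∀ x, f x ≤ 1) : E.toLinearMap f ≤ 1 := by
  obtain ⟨g, hg, hmono, hlim⟩ := exists_monotone_tendsto_indicator (isOpen_univ (X := Ω))
  let F (n : ℕ) : C₀(Ω, ℂ) := f + (ofRealC0 (g n) - f * ofRealC0 (g n))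
  have hF (n : ℕ) (x : Ω) : F n x = f x + (1 - f x) * (g n x : ℂ) := by
    simp only [F, ZeroAtInftyContinuousMap.add_apply, ZeroAtInftyContinuousMap.sub_apply,
      ZeroAtInftyContinuousMap.mul_apply, ofRealC0_apply]
    ring
  have hdiff (n : ℕ) (x : Ω) : 0 ≤ (1 - f x) * (g n x : ℂ) :=
    mul_nonneg (sub_nonneg.2 (hf1 x)) (Complex.zero_le_real.2 (hg n x).1)
  refine (ContinuousLinearMap.le_def _ _).2 (isPositive_of_inner_self_nonneg fun ψ => ?_)
  have htendsto := E.tendsto_one F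
    (fun n x => by rw [hF]; exact add_nonneg (hf0 x) (hdiff n x))
    (fun x i j hij => by
      simp only [hF]
      have := Complex.real_le_real.2 (hmono x hij)
      have := sub_nonneg.2 (hf1 x)
      gcongr)
    (fun x => by
      simp only [hF]
      have h := ((Complex.continuous_ofReal.tendsto _).comp (hlim x)).const_mul (1 - f x)
      simpa using h.const_add (f x)) ψ ψ
  rw [sub_apply, inner_sub_right, one_apply_eq_self]
  refine ge_of_tendsto (htendsto.sub_const _) (Eventually.of_forall fun n => ?_)
  rw [← inner_sub_right, ← sub_apply, ← map_sub]
  refine (E.isPositive _ fun x => ?_).inner_nonneg_right ψ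
  rw [ZeroAtInftyContinuousMap.sub_apply, hF, add_sub_cancel_left]
  exact hdiff n x

lemma star_mem_commutant {T : H →L[ℂ] H} (hT : T ∈ E.commutant) : star T ∈ E.commutant := by
  rintro _ ⟨f, rfl⟩
  have h := congrArg star (hT _ ⟨star f, rfl⟩)
  simpa [E.map_star] using h.symm

/-- The von Neumann algebra generated by the operators `E(f)`. -/
def doubleCommutant : StarSubalgebra ℂ (H →L[ℂ] H) := StarSubalgebra.centralizer ℂ E.commutant

lemma coe_doubleCommutant : (E.doubleCommutant : Set (H →L[ℂ] H)) = E.commutant.centralizer := by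
  rw [doubleCommutant, StarSubalgebra.coe_centralizer,
    Set.union_eq_self_of_subset_right fun T hT => star_star T ▸ E.star_mem_commutant hT]

lemma isClosed_doubleCommutant : IsClosed (E.doubleCommutant : Set (H →L[ℂ] H)) := by
  rw [coe_doubleCommutant]
  exact Set.isClosed_centralizer _

lemma map_mem_doubleCommutant (f : C₀(Ω, ℂ)) : E.toLinearMap f ∈ E.doubleCommutant := by
  rw [← SetLike.mem_coe, coe_doubleCommutant]
  exact Set.subset_centralizer_centralizer ⟨f, rfl⟩

variable {E} in
lemma IsCommutative.mul_comm_of_mem (hE : E.IsCommutative) :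
    ∀ S ∈ E.doubleCommutant, ∀ T ∈ E.doubleCommutant, S * T = T * S := by
  have hrange : Set.range E.toLinearMap ⊆ E.commutant := Set.range_subset_iff.2 hE
  intro S hS T hT
  rw [← SetLike.mem_coe, coe_doubleCommutant] at hS hT
  exact hT S (Set.centralizer_subset hrange hS)

lemma centralizer_eq_commutant {s : Set (H →L[ℂ] H)} (hs : Set.range E.toLinearMap ⊆ s)
    (hs' : s ⊆ E.doubleCommutant) : s.centralizer = E.commutant := by
  refine (Set.centralizer_subset hs).antisymm (Set.subset_centralizer_centralizer.trans ?_)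
  exact Set.centralizer_subset (E.coe_doubleCommutant ▸ hs')

variable [T2Space Ω] [LocallyCompactSpace Ω] [SecondCountableTopology Ω] [MeasurableSpace Ω]
  [BorelSpace Ω]

lemma exists_pairing_eq_character (χ : WeakDual.characterSpace ℂ E.doubleCommutant) :
    ∃ ν : PosBall Ω, ∀ f, ν.pairing f = χ ⟨E.toLinearMap f, E.map_mem_doubleCommutant f⟩ := by
  have := E.isClosed_doubleCommutant
  let Λ : C₀(Ω, ℂ) →ₗ[ℂ] ℂ :=
    (χ : WeakDual ℂ E.doubleCommutant).toLinearMap ∘ₗ E.toLinearMap.codRestrict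
      E.doubleCommutant.toSubalgebra.toSubmodule E.map_mem_doubleCommutant
  refine PosBall.exists_pairing_eq (Λ := Λ) (fun f hf => ?_) fun f hf0 hf1 => ?_
  · exact characterSpace_apply_nonneg χ
      ((ContinuousLinearMap.nonneg_iff_isPositive _).2 (E.isPositive f hf))
  · rw [← sub_nonneg]
    have h := characterSpace_apply_nonneg χ
      (a := 1 - ⟨E.toLinearMap f, E.map_mem_doubleCommutant f⟩)
      (sub_nonneg.2 (E.map_le_one hf0 hf1))
    rwa [map_sub, map_one] at h

/-- The measure on `Ω` that a character of the von Neumann algebra generated by `E` induces by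
composition with `E`. -/
def characterMeasure (χ : WeakDual.characterSpace ℂ E.doubleCommutant) : PosBall Ω :=
  (E.exists_pairing_eq_character χ).choose

lemma pairing_characterMeasure (χ : WeakDual.characterSpace ℂ E.doubleCommutant)
    (f : C₀(Ω, ℂ)) : (E.characterMeasure χ).pairing f =
      χ ⟨E.toLinearMap f, E.map_mem_doubleCommutant f⟩ :=
  (E.exists_pairing_eq_character χ).choose_spec f

lemma continuous_characterMeasure : Continuous E.characterMeasure := by
  refine PosBall.continuous_iff.2 fun f => ?_
  simp only [pairing_characterMeasure]
  exact (WeakDual.gelfandTransform ℂ E.doubleCommutant _).continuous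

lemma isCompact_range_characterMeasure : IsCompact (Set.range E.characterMeasure) := by
  have := E.isClosed_doubleCommutant
  exact isCompact_range E.continuous_characterMeasure

variable {E}

theorem IsCommutative.exists_isRepresentation (hE : E.IsCommutative) :
    ∃ P : PVM (Set.range E.characterMeasure) H,
      E.IsRepresentation P Subtype.val ∧ P.commutant = E.commutant := by
  have := E.isClosed_doubleCommutant
  have := isCompact_iff_compactSpace.1 E.isCompact_range_characterMeasure
  obtain ⟨π, hinj, hmem, hπ⟩ := exists_injective_starAlgHom_of_surjective hE.mul_comm_of_mem
    (m := ⟨_, E.continuous_characterMeasure.rangeFactorization⟩) Set.rangeFactorization_surjective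
  obtain ⟨P, hP⟩ := exists_PVM_isIntegral_starAlgHom π
  let ev (f : C₀(Ω, ℂ)) : C(Set.range E.characterMeasure, ℂ) :=
    ⟨fun ν => ν.1.pairing f, (PosBall.continuous_pairing f).comp continuous_subtype_val⟩
  have hev (f : C₀(Ω, ℂ)) : π (ev f) = E.toLinearMap f :=
    hπ ⟨_, E.map_mem_doubleCommutant f⟩ (ev f) fun χ => E.pairing_characterMeasure χ f
  have hsupp : P.support = Set.univ := POVM.support_eq_univ fun g hg =>
    (map_eq_zero_iff π hinj).1 ((hP g).unique hg)
  refine ⟨P, ⟨hsupp, continuous_subtype_val, Subtype.val_injective, fun f => ?_⟩, ?_⟩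
  · exact hev f ▸ hP (ev f)
  · rw [POVM.commutant_eq_centralizer_range hP]
    exact E.centralizer_eq_commutant (Set.range_subset_iff.2 fun f => ⟨ev f, hev f⟩)
      (Set.range_subset_iff.2 hmem)

end FunctionalPOVM

end Existence

end

theorem theorem1_general {Ω : Type u} [TopologicalSpace Ω] [T2Space Ω] [LocallyCompactSpace Ω]
    [SecondCountableTopology Ω] [MeasurableSpace Ω] [BorelSpace Ω]
    {H : Type v} [NormedAddCommGroup H] [InnerProductSpace ℂ H] [CompleteSpace H]
    (E : FunctionalPOVM Ω H) (hE : E.IsCommutative) :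
    ∃ (S : Type u) (_ : TopologicalSpace S) (_ : CompactSpace S)
      (_ : TopologicalSpace.MetrizableSpace S) (_ : MeasurableSpace S) (_ : BorelSpace S)
      (P : PVM S H) (μ : S → PosBall Ω),
      E.IsRepresentation P μ ∧
      (∀ (S' : Type w) [TopologicalSpace S'] [CompactSpace S'] [MeasurableSpace S'] [BorelSpace S']
        (P' : PVM S' H) (μ' : S' → PosBall Ω), E.IsRepresentation P' μ' →
        ∃ Φ : S ≃ₜ S',
          (∀ A : Set S', MeasurableSet A → P'.toFun A = P.toFun (Φ ⁻¹' A)) ∧ μ = μ' ∘ Φ) ∧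
      P.commutant = E.commutant := by
  have hcompact := isCompact_iff_compactSpace.1 E.isCompact_range_characterMeasure
  obtain ⟨P, hP, hcomm⟩ := hE.exists_isRepresentation
  exact ⟨Set.range E.characterMeasure, inferInstance, hcompact, inferInstance, inferInstance,
    inferInstance, P, Subtype.val, hP, fun S' _ _ _ _ P' μ' h' => hP.exists_homeomorph h', hcomm⟩

theorem theorem1 {Ω : Type u} [TopologicalSpace Ω] [T2Space Ω] [LocallyCompactSpace Ω]
    [SecondCountableTopology Ω] [MeasurableSpace Ω] [BorelSpace Ω]
    {H : Type v} [NormedAddCommGroup H] [InnerProductSpace ℂ H] [CompleteSpace H]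
    [TopologicalSpace.SeparableSpace H]
    (E : FunctionalPOVM Ω H) (hE : E.IsCommutative) :
    ∃ (S : Type u) (_ : TopologicalSpace S) (_ : CompactSpace S)
      (_ : TopologicalSpace.MetrizableSpace S) (_ : MeasurableSpace S) (_ : BorelSpace S)
      (P : PVM S H) (μ : S → PosBall Ω),
      E.IsRepresentation P μ ∧
      (∀ (S' : Type w) [TopologicalSpace S'] [CompactSpace S']
        [TopologicalSpace.MetrizableSpace S'] [MeasurableSpace S'] [BorelSpace S']
        (P' : PVM S' H) (μ' : S' → PosBall Ω), E.IsRepresentation P' μ' →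
        ∃ Φ : S ≃ₜ S',
          (∀ A : Set S', MeasurableSet A → P'.toFun A = P.toFun (Φ ⁻¹' A)) ∧ μ = μ' ∘ Φ) ∧
      P.commutant = E.commutant := by
  obtain ⟨S, hT, hC, hM, hS, hB, P, μ, hP, hunique, hcomm⟩ := theorem1_general E hE
  exact ⟨S, hT, hC, hM, hS, hB, P, μ, hP, fun S' _ _ _ _ _ => hunique S', hcomm⟩
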